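/- Let $L^2=L^2(\mathbb R^3)$ be the space of complex-valued square-integrable functions with norm $\|\cdot\|$, let $H^2=H^2(\mathbb R^3)$ be the Sobolev space with norm $\|f\|_{H^2}=\sqrt{\|(-\Delta)f\|^2+\|f\|^2}$, and let $\Delta_{S^2}$ be the Laplace–Beltrami operator of the unit sphere $S^2\subset\mathbb R^3$. For a twice differentiable function $\varphi$ on $\mathbb R^3$ let $$\Bigl(\tfrac{\Delta_{S^2}}{|x|^2}\varphi\Bigr)(r\omega)=\frac1{r^2}\,\bigl(\Delta_{S^2}\,\varphi(r\,\cdot)\bigr)(\omega)\qquad(r>0,\ \omega\in S^2).$$ For $f\in L^2$, we say that $\tfrac{\Delta_{S^2}}{|x|^2}f=g\in L^2$ (in the sense of distributions on $\mathbb R^3\setminus\{0\}$) if $\int g\varphi\,dx=\int f\,\tfrac{\Delta_{S^2}}{|x|^2}\varphi\,dx$ for all $\varphi\in C_c^\infty(\mathbb R^3\setminus\{0\})$. Then for every $f\in H^2$ there is exactly one $g\in L^2$ with $\tfrac{\Delta_{S^2}}{|x|^2}f=g$, and $$\Bigl\|\tfrac{\Delta_{S^2}}{|x|^2}f\Bigr\|\le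 22\,\|f\|_{H^2}.$$ Moreover, $\tfrac{\Delta_{S^2}}{|x|^2}$, defined pointwise on $C_c^\infty(\mathbb R^3)\subset H^2$ by the formula above, extends uniquely to a bounded linear operator $T:H^2\to L^2$; it satisfies $\|T\|_{H^2\to L^2}\le 22$, and $Tf=\tfrac{\Delta_{S^2}}{|x|^2}f$ in the sense of distributions on $\mathbb R^3\setminus\{0\}$ for every $f\in H^2$. -/

import Mathlib

open MeasureTheory TemperedDistribution
open scoped ContDiff ENNReal Laplacian SchwartzMap

noncomputable section

namespace SphericalHardy

/-- Euclidean space `ℝ³`. -/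
abbrev E3 : Type := EuclideanSpace ℝ (Fin 3)

/-- The Euclidean plane, the model space of the charts of `S²`. -/
abbrev E2 : Type := EuclideanSpace ℝ (Fin 2)

/-- The unit sphere `S² ⊆ ℝ³`. -/
abbrev S2 : Type := Metric.sphere (0 : E3) 1

/-- Complex-valued `L²(ℝ³)` with Lebesgue measure. -/
abbrev L2 : Type := Lp ℂ 2 (volume : Measure E3)

/-! ### The Sobolev space `H²(ℝ³)` -/

/-- The elements of `L²(ℝ³)` that lie in the Sobolev space `H²(ℝ³)`. -/
def sobolevH2 : Submodule ℂ L2 where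
  carrier := {f | MemSobolev 2 2 (f : 𝓢'(E3, ℂ))}
  add_mem' {f g} hf hg := by
    have h := MemSobolev.add hf hg
    simp only [← Lp.toTemperedDistributionCLM_apply, ← map_add] at h
    exact h
  zero_mem' := by
    have h := memSobolev_fun_zero E3 ℂ 2 2
    rw [← map_zero (Lp.toTemperedDistributionCLM ℂ (volume : Measure E3) 2)] at h
    exact h
  smul_mem' c f hf := by
    have h := MemSobolev.smul c hf
    simp only [← Lp.toTemperedDistributionCLM_apply, ← map_smul] at h
    exact h

theorem exists_laplacian (f : sobolevH2) :
    ∃ g : L2, Δ ((f : L2) : 𝓢'(E3, ℂ)) = (g : 𝓢'(E3, ℂ)) := by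
  have h : MemSobolev ((2 : ℝ) - 2) 2 (Δ ((f : L2) : 𝓢'(E3, ℂ))) := MemSobolev.laplacian f.2
  rw [sub_self] at h
  exact memSobolev_zero_iff.1 h

theorem toTemperedDistribution_injective :
    Function.Injective (Lp.toTemperedDistributionCLM ℂ (volume : Measure E3) 2) :=
  LinearMap.ker_eq_bot.1 Lp.ker_toTemperedDistributionCLM_eq_bot

/-- The distributional Laplacian `H² → L²`: `weakLaplacian f` is the unique element of `L²` that
represents the tempered distribution `Δ f`. -/
def weakLaplacian : sobolevH2 →ₗ[ℂ] L2 where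
  toFun f := (exists_laplacian f).choose
  map_add' f g := by
    apply toTemperedDistribution_injective
    rw [map_add]
    simp only [Lp.toTemperedDistributionCLM_apply]
    rw [← (exists_laplacian f).choose_spec, ← (exists_laplacian g).choose_spec,
      ← (exists_laplacian (f + g)).choose_spec]
    simp only [← Lp.toTemperedDistributionCLM_apply, Submodule.coe_add, map_add,
      ← TemperedDistribution.laplacianCLM_apply]
  map_smul' c f := by
    apply toTemperedDistribution_injective
    rw [RingHom.id_apply, map_smul]
    simp only [Lp.toTemperedDistributionCLM_apply]
    rw [← (exists_laplacian f).choose_spec, ← (exists_laplacian (c • f)).choose_spec]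
    simp only [← Lp.toTemperedDistributionCLM_apply, Submodule.coe_smul, map_smul,
      ← TemperedDistribution.laplacianCLM_apply]

theorem weakLaplacian_spec (f : sobolevH2) :
    Δ ((f : L2) : 𝓢'(E3, ℂ)) = ((weakLaplacian f : L2) : 𝓢'(E3, ℂ)) :=
  (exists_laplacian f).choose_spec

/-- The space `H²(ℝ³)`, a type of its own because it carries the `H²` norm and not the `L²` norm. -/
def H2 : Type := sobolevH2

namespace H2

instance : AddCommGroup H2 := inferInstanceAs (AddCommGroup sobolevH2)

instance : Module ℂ H2 := inferInstanceAs (Module ℂ sobolevH2)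

/-- The inclusion `H² ⊆ L²`. -/
def toL2 : H2 →ₗ[ℂ] L2 := sobolevH2.subtype

/-- The Laplacian `Δ : H² → L²`. -/
def lap : H2 →ₗ[ℂ] L2 := weakLaplacian

/-- The map `f ↦ (-Δ f, f)` into the Hilbert sum `L² ⊕ L²`, which induces the `H²` norm. -/
def graph : H2 →ₗ[ℂ] WithLp 2 (L2 × L2) :=
  (WithLp.linearEquiv 2 ℂ (L2 × L2)).symm.toLinearMap ∘ₗ (-lap).prod toL2

theorem graph_injective : Function.Injective graph := fun _ _ h =>
  Subtype.ext (congrArg (fun p : WithLp 2 (L2 × L2) => p.snd) h)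

instance : NormedAddCommGroup H2 :=
  NormedAddCommGroup.induced H2 (WithLp 2 (L2 × L2)) graph graph_injective

instance : NormedSpace ℂ H2 := NormedSpace.induced ℂ H2 (WithLp 2 (L2 × L2)) graph

/-- The norm of `H²` is `‖f‖_{H²} = √(‖-Δ f‖² + ‖f‖²)`. -/
theorem norm_eq (f : H2) : ‖f‖ = √(‖-lap f‖ ^ 2 + ‖toL2 f‖ ^ 2) :=
  WithLp.prod_norm_eq_of_L2 (graph f)

end H2

/-! ### The Laplace–Beltrami operator of `S²` -/

/-- The inverse of the stereographic chart of `S²` centred at `p`, a local parametrization of the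
sphere by the plane. -/
def param (p : S2) (y : E2) : S2 := (chartAt E2 p).symm y

/-- The `i`-th partial derivative of a map on the plane. -/
def partialDeriv {V : Type*} [NormedAddCommGroup V] [NormedSpace ℝ V] (i : Fin 2) (F : E2 → V)
    (y : E2) : V :=
  fderiv ℝ F y (EuclideanSpace.single i 1)

/-- The matrix `(g_{ij})` of the round metric, that is, of the metric induced from `ℝ³`, in the
stereographic chart centred at `p`. -/
def metricMatrix (p : S2) (y : E2) : Matrix (Fin 2) (Fin 2) ℝ := fun i j =>
  inner ℝ (partialDeriv i (fun z => (param p z : E3)) y)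
    (partialDeriv j (fun z => (param p z : E3)) y)

/-- The Laplace–Beltrami operator of the round sphere `S²`, by the formula
`Δ u = (det g)^{-1/2} ∑ᵢ ∂ᵢ ((det g)^{1/2} ∑ⱼ g^{ij} ∂ⱼ u)` in local coordinates. The coordinates
used at `p` are those of the stereographic chart centred at `p`. -/
def laplaceBeltrami (u : S2 → ℂ) (p : S2) : ℂ :=
  let y₀ : E2 := chartAt E2 p p
  (√(metricMatrix p y₀).det)⁻¹ • ∑ i, partialDeriv i
    (fun y => √(metricMatrix p y).det •
      ∑ j, (metricMatrix p y)⁻¹ i j • partialDeriv j (fun z => u (param p z)) y) y₀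

/-- The direction `x / |x| ∈ S²` of a nonzero vector. -/
def direction (x : E3) (hx : x ≠ 0) : S2 :=
  ⟨‖x‖⁻¹ • x, by simp [norm_smul, hx]⟩

open Classical in
/-- The function `(Δ_{S²} / |x|²) φ` for a (twice differentiable) function `φ` on `ℝ³`: at
`x = r p` with `r = |x| > 0` and `p ∈ S²`, the operator `Δ_{S²}` is applied to the function
`θ ↦ φ (r θ)` on `S²`, and the result at `p` is divided by `r²`. The value at the
origin, a null set, is irrelevant. -/
def angular (φ : E3 → ℂ) (x : E3) : ℂ :=
  if hx : x = 0 then 0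
  else (‖x‖ ^ 2)⁻¹ • laplaceBeltrami (fun θ => φ (‖x‖ • (θ : E3))) (direction x hx)

/-- `g = (Δ_{S²} / |x|²) f` in the sense of distributions on `ℝ³ \ {0}`. The operator
`Δ_{S²} / |x|²` has smooth real coefficients there and is its own formal transpose, because `Δ_{S²}`
is symmetric on every sphere. -/
def IsWeakAngular (f g : L2) : Prop :=
  ∀ φ : E3 → ℂ, ContDiff ℝ ∞ φ → HasCompactSupport φ → (0 : E3) ∉ tsupport φ →
    ∫ x, g x * φ x = ∫ x, f x * angular φ x

/-- `T` extends `Δ_{S²} / |x|²` from `C_c^∞(ℝ³)`. -/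
def ExtendsAngular (T : H2 →L[ℂ] L2) : Prop :=
  ∀ φ : E3 → ℂ, ContDiff ℝ ∞ φ → HasCompactSupport φ →
    ∃ f : H2, (f.toL2 : E3 → ℂ) =ᵐ[volume] φ ∧ (T f : E3 → ℂ) =ᵐ[volume] angular φ

end SphericalHardy

end

/-!
In polar coordinates `Δ_{S²} / |x|² = Δ - (∂ᵣ² + 2 r⁻¹ ∂ᵣ)`, so both the estimate and the symmetry
reduce to the radial part of the Laplacian. For `φ ∈ C_c^∞(ℝ³)`, integration by parts shows that
the Hessian of `φ` has the same `L²` norm as `Δ φ`. It dominates `∂ᵣ² φ` pointwise, and Hardy's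
inequality for `∇φ` gives `‖r⁻¹ ∂ᵣ φ‖ ≤ 2 ‖Δ φ‖`; altogether
`‖(Δ_{S²} / |x|²) φ‖ ≤ (1 + 1 + 2 · 2) ‖Δ φ‖`, and `C_c^∞(ℝ³)` is dense in `H²`. The radial part is
symmetric away from the origin because in dimension `d` it equals `r⁻² ((r ∂ᵣ)² + (d - 2) r ∂ᵣ)`,
and the transpose of the Euler operator `r ∂ᵣ` is `-(r ∂ᵣ + d)`.

The polar formula holds because stereographic coordinates are conformal: in dimension two the
Laplace–Beltrami operator is then the flat Laplacian divided by the square of the conformal factor,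
and this factor is `1` at the centre of the chart.
-/

noncomputable section

namespace SphericalHardy

open Filter InnerProductSpace Module
open scoped LineDeriv Topology

section ELpNorm

variable {α ι F : Type*} [MeasurableSpace α] {μ : Measure α} [NormedAddCommGroup F]

theorem eLpNorm_two_sq_eq_lintegral (f : α → F) :
    eLpNorm f 2 μ ^ 2 = ∫⁻ x, ‖f x‖ₑ ^ 2 ∂μ := by
  simpa using eLpNorm_nnreal_pow_eq_lintegral (f := f) (μ := μ) (p := 2) two_ne_zero

theorem eLpNorm_two_sq_eq_integral {f : α → F} (hf : MemLp f 2 μ) :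
    eLpNorm f 2 μ ^ 2 = ENNReal.ofReal (∫ x, ‖f x‖ ^ 2 ∂μ) := by
  rw [eLpNorm_two_sq_eq_lintegral,
    ofReal_integral_eq_lintegral_ofReal hf.norm.integrable_sq (.of_forall fun x => by positivity)]
  simp only [ENNReal.ofReal_pow (norm_nonneg _), ofReal_norm]

theorem eLpNorm_two_le_of_integral_norm_sq_le {F G : Type*} [NormedAddCommGroup F]
    [NormedAddCommGroup G] {f : α → F} {g : α → G} (hf : MemLp f 2 μ) (hg : MemLp g 2 μ) {c : ℝ}
    (hc : 0 ≤ c) (h : ∫ x, ‖f x‖ ^ 2 ∂μ ≤ c ^ 2 * ∫ x, ‖g x‖ ^ 2 ∂μ) :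
    eLpNorm f 2 μ ≤ ENNReal.ofReal c * eLpNorm g 2 μ := by
  rw [← ENNReal.pow_le_pow_left_iff two_ne_zero, mul_pow, eLpNorm_two_sq_eq_integral hf,
    eLpNorm_two_sq_eq_integral hg, ← ENNReal.ofReal_pow hc, ← ENNReal.ofReal_mul (sq_nonneg c)]
  exact ENNReal.ofReal_le_ofReal h

theorem eLpNorm_two_sq_le_sum [Fintype ι] {G : ι → Type*} [∀ i, NormedAddCommGroup (G i)]
    {f : α → F} {g : ∀ i, α → G i} (hg : ∀ i, AEStronglyMeasurable (g i) μ)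
    (h : ∀ x, ‖f x‖ ^ 2 ≤ ∑ i, ‖g i x‖ ^ 2) :
    eLpNorm f 2 μ ^ 2 ≤ ∑ i, eLpNorm (g i) 2 μ ^ 2 := by
  simp only [eLpNorm_two_sq_eq_lintegral]
  rw [← lintegral_finsetSum' _ fun i _ => (hg i).enorm.pow_const 2]
  refine lintegral_mono fun x => ?_
  simp only [← ofReal_norm, ← ENNReal.ofReal_pow (norm_nonneg _)]
  rw [← ENNReal.ofReal_sum_of_nonneg fun i _ => by positivity]
  exact ENNReal.ofReal_le_ofReal (h x)

end ELpNorm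

section EulerIdentity

variable {E F : Type*} [NormedAddCommGroup E] [NormedSpace ℝ E] [MeasurableSpace E] [BorelSpace E]
  {μ : Measure E} [NormedAddCommGroup F] [NormedSpace ℝ F]

theorem integrable_fderiv_apply_self [IsFiniteMeasureOnCompacts μ] {h : E → F}
    (hh : ContDiff ℝ 1 h) (hc : HasCompactSupport h) :
    Integrable (fun x => fderiv ℝ h x x) μ :=
  ((hh.continuous_fderiv one_ne_zero).clm_apply continuous_id).integrable_of_hasCompactSupport
    ((hc.fderiv ℝ).mono fun x hx h0 => hx (by simp [h0]))

variable [FiniteDimensional ℝ E] [μ.IsAddHaarMeasure]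

theorem integral_fderiv_apply_self {h : E → F} (hh : ContDiff ℝ 1 h) (hc : HasCompactSupport h) :
    ∫ x, fderiv ℝ h x x ∂μ = -(finrank ℝ E : ℝ) • ∫ x, h x ∂μ := by
  let b := finBasis ℝ E
  have hint (i) : Integrable (fun x => b.coord i x • fderiv ℝ h x (b i)) μ :=
    Continuous.integrable_of_hasCompactSupport
      ((LinearMap.continuous_of_finiteDimensional (b.coord i)).smul
        ((hh.continuous_fderiv one_ne_zero).clm_apply continuous_const))
      ((hc.fderiv_apply ℝ (b i)).smul_left)
  have hparts (i) : ∫ x, b.coord i x • fderiv ℝ h x (b i) ∂μ = -∫ x, h x ∂μ := by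
    have hcoord (x : E) : HasFDerivAt (b.coord i) (LinearMap.toContinuousLinearMap (b.coord i)) x :=
      (LinearMap.toContinuousLinearMap (b.coord i)).hasFDerivAt
    have hone (x : E) : fderiv ℝ (b.coord i) x (b i) = 1 := by
      simp [(hcoord x).fderiv]
    rw [integral_smul_fderiv_eq_neg_fderiv_smul_of_integrable _ (hint i)]
    · simp only [hone, one_smul]
    · exact Continuous.integrable_of_hasCompactSupport
        ((LinearMap.continuous_of_finiteDimensional (b.coord i)).smul hh.continuous) hc.smul_left
    · exact fun x _ => (hcoord x).differentiableAt
    · exact fun x _ => hh.differentiable one_ne_zero x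
    · simpa only [hone, one_smul] using hh.continuous.integrable_of_hasCompactSupport hc
  calc ∫ x, fderiv ℝ h x x ∂μ = ∫ x, ∑ i, b.coord i x • fderiv ℝ h x (b i) ∂μ := by
        refine integral_congr_ae (.of_forall fun x => ?_)
        simp only [Basis.coord_apply, ← map_smul, ← map_sum, b.sum_repr]
    _ = -(finrank ℝ E : ℝ) • ∫ x, h x ∂μ := by
        simp only [integral_finsetSum _ fun i _ => hint i, hparts, Finset.sum_const,
          Finset.card_univ, Fintype.card_fin, smul_neg, neg_smul, Nat.cast_smul_eq_nsmul]

end EulerIdentity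

section Hardy

variable {E F : Type*} [NormedAddCommGroup E] [InnerProductSpace ℝ E]
  [NormedAddCommGroup F] [InnerProductSpace ℝ F] {ψ : E → F} {ε : ℝ}

theorem fderiv_inv_norm_sq_add_mul_norm_sq_apply_self {x : E} (hψ : DifferentiableAt ℝ ψ x)
    (hε : 0 < ε) :
    fderiv ℝ (fun y => (‖y‖ ^ 2 + ε)⁻¹ * ‖ψ y‖ ^ 2) x x =
      2 * (‖x‖ ^ 2 + ε)⁻¹ * inner ℝ (ψ x) (fderiv ℝ ψ x x) -
        2 * ‖x‖ ^ 2 * ((‖x‖ ^ 2 + ε)⁻¹) ^ 2 * ‖ψ x‖ ^ 2 := by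
  have hne : ‖x‖ ^ 2 + ε ≠ 0 := by positivity
  have hweight := (hasDerivAt_inv hne).comp_hasFDerivAt x
    ((hasStrictFDerivAt_norm_sq x).hasFDerivAt.add_const ε)
  have h : HasFDerivAt (fun y => (‖y‖ ^ 2 + ε)⁻¹ * ‖ψ y‖ ^ 2) _ x :=
    hweight.mul hψ.hasFDerivAt.norm_sq
  rw [h.fderiv]
  simp only [Function.comp_apply, neg_smul, smul_neg, add_apply, smul_apply,
    ContinuousLinearMap.comp_apply, coe_innerSL_apply, nsmul_eq_mul, Nat.cast_ofNat, smul_eq_mul,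
    neg_apply, inner_self_eq_norm_sq_to_K, Real.ringHom_apply, inv_pow]
  ring

theorem neg_fderiv_inv_norm_sq_add_mul_norm_sq_apply_self_le {x : E}
    (hψ : DifferentiableAt ℝ ψ x) (hε : 0 < ε) {a : ℝ} (ha : 0 < a) :
    -fderiv ℝ (fun y => (‖y‖ ^ 2 + ε)⁻¹ * ‖ψ y‖ ^ 2) x x ≤
      (2 + a) * ((‖x‖ ^ 2 + ε)⁻¹ * ‖ψ x‖ ^ 2) + a⁻¹ * ‖fderiv ℝ ψ x‖ ^ 2 := by
  rw [fderiv_inv_norm_sq_add_mul_norm_sq_apply_self hψ hε]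
  set ρ := (‖x‖ ^ 2 + ε)⁻¹ with hρ
  have : 0 < ρ := by positivity
  have hρ_le : ‖x‖ ^ 2 * ρ ≤ 1 := by
    rw [hρ, mul_inv_le_iff₀ (by positivity)]
    linarith
  have hinner : -inner ℝ (ψ x) (fderiv ℝ ψ x x) ≤ ‖ψ x‖ * (‖fderiv ℝ ψ x‖ * ‖x‖) :=
    (neg_le_abs _).trans ((abs_real_inner_le_norm _ _).trans
      (mul_le_mul_of_nonneg_left ((fderiv ℝ ψ x).le_opNorm x) (norm_nonneg _)))
  have hamgm : 2 * ‖ψ x‖ * (‖fderiv ℝ ψ x‖ * ‖x‖) ≤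
      a * ‖ψ x‖ ^ 2 + a⁻¹ * (‖fderiv ℝ ψ x‖ * ‖x‖) ^ 2 := by
    have h := mul_nonneg (inv_nonneg.2 ha.le) (sq_nonneg (a * ‖ψ x‖ - ‖fderiv ℝ ψ x‖ * ‖x‖))
    field_simp at h ⊢
    linarith
  calc -(2 * ρ * inner ℝ (ψ x) (fderiv ℝ ψ x x) - 2 * ‖x‖ ^ 2 * ρ ^ 2 * ‖ψ x‖ ^ 2)
      = ρ * (2 * -inner ℝ (ψ x) (fderiv ℝ ψ x x)) + 2 * (‖x‖ ^ 2 * ρ) * (ρ * ‖ψ x‖ ^ 2) := by ring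
    _ ≤ ρ * (a * ‖ψ x‖ ^ 2 + a⁻¹ * (‖fderiv ℝ ψ x‖ * ‖x‖) ^ 2) + 2 * 1 * (ρ * ‖ψ x‖ ^ 2) := by
        gcongr
        linarith
    _ = (2 + a) * (ρ * ‖ψ x‖ ^ 2) + a⁻¹ * ((‖x‖ ^ 2 * ρ) * ‖fderiv ℝ ψ x‖ ^ 2) := by ring
    _ ≤ (2 + a) * (ρ * ‖ψ x‖ ^ 2) + a⁻¹ * (1 * ‖fderiv ℝ ψ x‖ ^ 2) := by gcongr
    _ = _ := by rw [one_mul]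

variable [FiniteDimensional ℝ E] [MeasurableSpace E] [BorelSpace E] {μ : Measure E}
  [μ.IsAddHaarMeasure]

theorem hardy_inequality_regularized (hE : 2 < finrank ℝ E) (hψ : ContDiff ℝ 1 ψ)
    (hc : HasCompactSupport ψ) (hε : 0 < ε) :
    ∫ x, (‖x‖ ^ 2 + ε)⁻¹ * ‖ψ x‖ ^ 2 ∂μ ≤
      (2 / (finrank ℝ E - 2 : ℝ)) ^ 2 * ∫ x, ‖fderiv ℝ ψ x‖ ^ 2 ∂μ := by
  obtain ⟨d, hd⟩ : ∃ d : ℝ, finrank ℝ E = d := ⟨_, rfl⟩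
  have hd_pos : 0 < d - 2 := by
    rw [← hd, sub_pos]
    exact_mod_cast hE
  have hweight : ContDiff ℝ 1 fun y : E => (‖y‖ ^ 2 + ε)⁻¹ * ‖ψ y‖ ^ 2 :=
    (((contDiff_norm_sq ℝ).add contDiff_const).inv fun x => by positivity).mul (hψ.norm_sq ℝ)
  have hweight_supp : HasCompactSupport fun y : E => (‖y‖ ^ 2 + ε)⁻¹ * ‖ψ y‖ ^ 2 :=
    hc.mono fun x hx h0 => hx (by simp [h0])
  have hweight_int : Integrable (fun x => (‖x‖ ^ 2 + ε)⁻¹ * ‖ψ x‖ ^ 2) μ :=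
    hweight.continuous.integrable_of_hasCompactSupport hweight_supp
  have hgrad_int : Integrable (fun x => ‖fderiv ℝ ψ x‖ ^ 2) μ :=
    ((hψ.continuous_fderiv one_ne_zero).norm.pow 2).integrable_of_hasCompactSupport
      ((hc.fderiv ℝ).mono fun x hx h0 => hx (by simp [h0]))
  -- Among the parameters `a` of the pointwise bound, `(d - 2) / 2` gives the sharp constant.
  have hle : d * ∫ x, (‖x‖ ^ 2 + ε)⁻¹ * ‖ψ x‖ ^ 2 ∂μ ≤
      (2 + (d - 2) / 2) * ∫ x, (‖x‖ ^ 2 + ε)⁻¹ * ‖ψ x‖ ^ 2 ∂μ +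
        ((d - 2) / 2)⁻¹ * ∫ x, ‖fderiv ℝ ψ x‖ ^ 2 ∂μ := by
    rw [← integral_const_mul (2 + _), ← integral_const_mul (_⁻¹),
      ← integral_add (hweight_int.const_mul _) (hgrad_int.const_mul _)]
    refine le_of_eq_of_le ?_ (integral_mono (integrable_fderiv_apply_self hweight hweight_supp).neg
      ((hweight_int.const_mul _).add (hgrad_int.const_mul _)) fun x =>
      neg_fderiv_inv_norm_sq_add_mul_norm_sq_apply_self_le (hψ.differentiable one_ne_zero x) hε
        (half_pos hd_pos))
    simp only [Pi.neg_apply, integral_neg, integral_fderiv_apply_self hweight hweight_supp, hd,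
      smul_eq_mul, neg_mul, neg_neg]
  rw [inv_div] at hle
  rw [hd, sq, mul_assoc, div_mul_eq_mul_div, le_div_iff₀ hd_pos]
  linarith

theorem hardy_inequality (hE : 2 < finrank ℝ E) (hψ : ContDiff ℝ 1 ψ)
    (hc : HasCompactSupport ψ) :
    eLpNorm (fun x => ‖x‖⁻¹ • ψ x) 2 μ ≤
      ENNReal.ofReal (2 / (finrank ℝ E - 2 : ℝ)) * eLpNorm (fderiv ℝ ψ) 2 μ := by
  have hd : (0 : ℝ) < finrank ℝ E - 2 := sub_pos.2 (by exact_mod_cast hE)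
  have : Nontrivial E := nontrivial_of_finrank_pos (two_pos.trans hE)
  let ε (n : ℕ) : ℝ := 1 / (n + 1)
  have hε (n) : 0 < ε n := Nat.one_div_pos_of_nat
  let f (n : ℕ) (x : E) : F := √((‖x‖ ^ 2 + ε n)⁻¹) • ψ x
  have hf_cont (n) : Continuous (f n) :=
    (Real.continuous_sqrt.comp (Continuous.inv₀ (by fun_prop) fun x => by
      have := hε n; positivity)).smul hψ.continuous
  have hf_bound (n) : eLpNorm (f n) 2 μ ≤
      ENNReal.ofReal (2 / (finrank ℝ E - 2 : ℝ)) * eLpNorm (fderiv ℝ ψ) 2 μ := by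
    refine eLpNorm_two_le_of_integral_norm_sq_le
      ((hf_cont n).memLp_of_hasCompactSupport hc.smul_left)
      ((hψ.continuous_fderiv one_ne_zero).memLp_of_hasCompactSupport (hc.fderiv ℝ))
      (by positivity) ?_
    refine (hardy_inequality_regularized hE hψ hc (hε n)).trans_eq'
      (integral_congr_ae (.of_forall fun x => ?_))
    have := hε n
    simp only [f, norm_smul, mul_pow, Real.norm_of_nonneg (Real.sqrt_nonneg _)]
    rw [Real.sq_sqrt (by positivity)]
  have hf_lim : ∀ᵐ x ∂μ, Tendsto (fun n => f n x) atTop (𝓝 (‖x‖⁻¹ • ψ x)) := by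
    filter_upwards [measure_eq_zero_iff_ae_notMem.1 (measure_singleton (μ := μ) (0 : E))] with x hx
    have hlim : Tendsto (fun n => ‖x‖ ^ 2 + ε n) atTop (𝓝 (‖x‖ ^ 2)) := by
      simpa only [add_zero] using tendsto_one_div_add_atTop_nhds_zero_nat.const_add (‖x‖ ^ 2)
    have h := (hlim.inv₀ (by simpa using hx)).sqrt.smul_const (ψ x)
    rwa [Real.sqrt_inv, Real.sqrt_sq (norm_nonneg x)] at h
  exact (Lp.eLpNorm_lim_le_liminf_eLpNorm (fun n => (hf_cont n).aestronglyMeasurable) _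
    hf_lim).trans (liminf_le_of_le (by isBoundedDefault) fun b hb =>
      hb.exists.elim fun n hn => hn.trans (hf_bound n))

end Hardy

section Coordinates

variable {ι E F : Type*} [Fintype ι] [NormedAddCommGroup E] [InnerProductSpace ℝ E]
  [NormedAddCommGroup F] [NormedSpace ℝ F]

theorem norm_apply_sq_le_sum (b : OrthonormalBasis ι ℝ E) (L : E →L[ℝ] F) (v : E) :
    ‖L v‖ ^ 2 ≤ (∑ i, ‖L (b i)‖ ^ 2) * ‖v‖ ^ 2 := by
  calc ‖L v‖ ^ 2 = ‖∑ i, b.repr v i • L (b i)‖ ^ 2 := by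
        simp only [← map_smul, ← map_sum, b.sum_repr]
    _ ≤ (∑ i, ‖L (b i)‖ * ‖b.repr v i‖) ^ 2 := by
        gcongr
        exact (norm_sum_le _ _).trans_eq (by simp only [norm_smul, mul_comm])
    _ ≤ (∑ i, ‖L (b i)‖ ^ 2) * ∑ i, ‖b.repr v i‖ ^ 2 := Finset.sum_mul_sq_le_sq_mul_sq _ _ _
    _ = (∑ i, ‖L (b i)‖ ^ 2) * ‖v‖ ^ 2 := by
        rw [← EuclideanSpace.norm_sq_eq, b.repr.norm_map]

theorem opNorm_sq_le_sum (b : OrthonormalBasis ι ℝ E) (L : E →L[ℝ] F) :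
    ‖L‖ ^ 2 ≤ ∑ i, ‖L (b i)‖ ^ 2 := by
  refine (Real.le_sqrt (norm_nonneg _) (by positivity)).1
    (L.opNorm_le_bound (Real.sqrt_nonneg _) fun v => ?_)
  refine le_of_sq_le_sq ?_ (by positivity)
  rw [mul_pow, Real.sq_sqrt (by positivity)]
  exact norm_apply_sq_le_sum b L v

end Coordinates

section ChainRule

variable {E F G : Type*} [NormedAddCommGroup E] [NormedSpace ℝ E] [NormedAddCommGroup F]
  [NormedSpace ℝ F] [NormedAddCommGroup G] [NormedSpace ℝ G]

theorem fderiv_fderiv_apply_const {f : E → F} {x : E} (hf : ContDiffAt ℝ 2 f x) (v w : E) :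
    fderiv ℝ (fun y => fderiv ℝ f y w) x v = fderiv ℝ (fderiv ℝ f) x v w := by
  rw [fderiv_clm_apply ((hf.fderiv_right le_rfl).differentiableAt one_ne_zero)
    (differentiableAt_const w)]
  simp

theorem fderiv_fderiv_comp_apply {f : F → G} {X : E → F} {x : E} (hf : ContDiff ℝ 2 f)
    (hX : ContDiff ℝ 2 X) (v w : E) :
    fderiv ℝ (fderiv ℝ fun y => f (X y)) x v w =
      fderiv ℝ (fderiv ℝ f) (X x) (fderiv ℝ X x v) (fderiv ℝ X x w) +
        fderiv ℝ f (X x) (fderiv ℝ (fderiv ℝ X) x v w) := by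
  have hX' := hX.differentiable two_ne_zero
  have hf' := (hf.fderiv_right (m := 1) le_rfl).differentiable one_ne_zero
  have hX'' := (hX.fderiv_right (m := 1) le_rfl).differentiable one_ne_zero
  have hcomp : fderiv ℝ (fun y => f (X y)) = fun y => (fderiv ℝ f (X y)).comp (fderiv ℝ X y) :=
    funext fun y => fderiv_comp y (hf.differentiable two_ne_zero (X y)) (hX' y)
  have h := ((hf' (X x)).hasFDerivAt.comp x (hX' x).hasFDerivAt).clm_comp (hX'' x).hasFDerivAt
  rw [hcomp, HasFDerivAt.fderiv (f := fun y => (fderiv ℝ f (X y)).comp (fderiv ℝ X y)) h]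
  simp [add_comm]

end ChainRule

section Hessian

variable {ι E F : Type*} [Fintype ι] [NormedAddCommGroup E] [InnerProductSpace ℝ E]
  [NormedAddCommGroup F] [InnerProductSpace ℝ F]

theorem lineDerivOp_lineDerivOp_apply_eq_fderiv (φ : 𝓢(E, F)) (v w x : E) :
    ∂_{v} (∂_{w} φ) x = fderiv ℝ (fderiv ℝ φ) x v w := by
  have h (y : E) : ∂_{w} φ y = fderiv ℝ φ y w := SchwartzMap.lineDerivOp_apply_eq_fderiv w φ y
  rw [SchwartzMap.lineDerivOp_apply_eq_fderiv, funext h,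
    fderiv_fderiv_apply_const (φ.smooth 2).contDiffAt]

theorem lineDerivOp_comm (φ : 𝓢(E, F)) (v w : E) : ∂_{v} (∂_{w} φ) = ∂_{w} (∂_{v} φ) := by
  ext x
  rw [lineDerivOp_lineDerivOp_apply_eq_fderiv, lineDerivOp_lineDerivOp_apply_eq_fderiv]
  exact (φ.smooth 2).contDiffAt.isSymmSndFDerivAt (by simp) v w

theorem norm_inv_norm_sq_smul_fderiv_apply_self_sq_le (b : OrthonormalBasis ι ℝ E) (φ : 𝓢(E, F))
    (x : E) : ‖(‖x‖ ^ 2)⁻¹ • fderiv ℝ φ x x‖ ^ 2 ≤ ∑ j, ‖‖x‖⁻¹ • ∂_{b j} φ x‖ ^ 2 := by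
  rcases eq_or_ne x 0 with rfl | hx
  · simp
  have : 0 < ‖x‖ := norm_pos_iff.2 hx
  simp only [norm_smul, mul_pow, norm_inv, norm_pow, norm_norm, ← Finset.mul_sum,
    SchwartzMap.lineDerivOp_apply_eq_fderiv]
  calc ((‖x‖ ^ 2)⁻¹) ^ 2 * ‖fderiv ℝ φ x x‖ ^ 2
      ≤ ((‖x‖ ^ 2)⁻¹) ^ 2 * ((∑ j, ‖fderiv ℝ φ x (b j)‖ ^ 2) * ‖x‖ ^ 2) := by
        gcongr
        exact norm_apply_sq_le_sum b _ x
    _ = (‖x‖⁻¹) ^ 2 * ∑ j, ‖fderiv ℝ φ x (b j)‖ ^ 2 := by field_simp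

theorem norm_inv_norm_sq_smul_fderiv_fderiv_apply_self_sq_le (b : OrthonormalBasis ι ℝ E)
    (φ : 𝓢(E, F)) (x : E) :
    ‖(‖x‖ ^ 2)⁻¹ • fderiv ℝ (fderiv ℝ φ) x x x‖ ^ 2 ≤
      ∑ ij : ι × ι, ‖∂_{b ij.1} (∂_{b ij.2} φ) x‖ ^ 2 := by
  rcases eq_or_ne x 0 with rfl | hx
  · simp only [map_zero, smul_zero, norm_zero, zero_pow two_ne_zero]
    positivity
  have : 0 < ‖x‖ := norm_pos_iff.2 hx
  simp only [norm_smul, mul_pow, norm_inv, norm_pow, norm_norm, Fintype.sum_prod_type,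
    lineDerivOp_lineDerivOp_apply_eq_fderiv]
  rw [inv_pow, inv_mul_le_iff₀ (by positivity)]
  set H := fderiv ℝ (fderiv ℝ φ) x
  calc ‖H x x‖ ^ 2 ≤ (∑ j, ‖H x (b j)‖ ^ 2) * ‖x‖ ^ 2 := norm_apply_sq_le_sum b _ x
    _ ≤ (∑ j, (∑ i, ‖H (b i) (b j)‖ ^ 2) * ‖x‖ ^ 2) * ‖x‖ ^ 2 := by
        gcongr with j
        exact norm_apply_sq_le_sum b (H.flip (b j)) x
    _ = (‖x‖ ^ 2) ^ 2 * ∑ i, ∑ j, ‖H (b i) (b j)‖ ^ 2 := by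
        rw [← Finset.sum_mul, Finset.sum_comm]
        ring

variable [FiniteDimensional ℝ E] [MeasurableSpace E] [BorelSpace E] {μ : Measure E}
  [μ.IsAddHaarMeasure]

theorem integral_inner_lineDerivOp_right (f g : 𝓢(E, F)) (v : E) :
    ∫ x, inner ℝ (f x) (∂_{v} g x) ∂μ = -∫ x, inner ℝ (∂_{v} f x) (g x) ∂μ :=
  SchwartzMap.integral_bilinear_lineDerivOp_right_eq_neg_left f g (innerSL ℝ) v

theorem integral_norm_lineDerivOp_lineDerivOp_sq (φ : 𝓢(E, F)) (v w : E) :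
    ∫ x, ‖∂_{v} (∂_{w} φ) x‖ ^ 2 ∂μ =
      ∫ x, inner ℝ (∂_{v} (∂_{v} φ) x) (∂_{w} (∂_{w} φ) x) ∂μ := by
  simp only [← real_inner_self_eq_norm_sq]
  rw [integral_inner_lineDerivOp_right, lineDerivOp_comm φ v w, lineDerivOp_comm (∂_{v} φ) v w,
    ← integral_inner_lineDerivOp_right]

theorem integrable_inner (f g : 𝓢(E, F)) : Integrable (fun x => inner ℝ (f x) (g x)) μ :=
  (SchwartzMap.pairing (innerSL ℝ) f g).integrable

theorem sum_eLpNorm_hessian_sq (b : OrthonormalBasis ι ℝ E) (φ : 𝓢(E, F)) :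
    ∑ ij : ι × ι, eLpNorm (∂_{b ij.1} (∂_{b ij.2} φ) : 𝓢(E, F)) 2 μ ^ 2 =
      eLpNorm (Δ φ : 𝓢(E, F)) 2 μ ^ 2 := by
  have hlap (x : E) : ‖(Δ φ : 𝓢(E, F)) x‖ ^ 2 =
      ∑ ij : ι × ι, inner ℝ (∂_{b ij.1} (∂_{b ij.1} φ) x) (∂_{b ij.2} (∂_{b ij.2} φ) x) := by
    rw [← real_inner_self_eq_norm_sq, SchwartzMap.laplacian_eq_sum b, sum_apply, sum_inner,
      Fintype.sum_prod_type]
    simp only [inner_sum]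
  simp only [eLpNorm_two_sq_eq_integral (SchwartzMap.memLp (_ : 𝓢(E, F)) 2 μ), hlap]
  rw [integral_finsetSum _ fun ij _ => integrable_inner _ _,
    ← ENNReal.ofReal_sum_of_nonneg fun ij _ => by positivity]
  simp only [integral_norm_lineDerivOp_lineDerivOp_sq]

theorem eLpNorm_inv_norm_sq_smul_fderiv_fderiv_apply_self_le (φ : 𝓢(E, F)) :
    eLpNorm (fun x => (‖x‖ ^ 2)⁻¹ • fderiv ℝ (fderiv ℝ φ) x x x) 2 μ ≤
      eLpNorm (Δ φ : 𝓢(E, F)) 2 μ := by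
  let b := stdOrthonormalBasis ℝ E
  rw [← ENNReal.pow_le_pow_left_iff two_ne_zero, ← sum_eLpNorm_hessian_sq b]
  exact eLpNorm_two_sq_le_sum (fun ij => (SchwartzMap.memLp _ 2 μ).1)
    (norm_inv_norm_sq_smul_fderiv_fderiv_apply_self_sq_le b φ)

theorem eLpNorm_inv_norm_sq_smul_fderiv_apply_self_le (hE : 2 < finrank ℝ E) {φ : 𝓢(E, F)}
    (hc : HasCompactSupport φ) :
    eLpNorm (fun x => (‖x‖ ^ 2)⁻¹ • fderiv ℝ φ x x) 2 μ ≤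
      ENNReal.ofReal (2 / (finrank ℝ E - 2 : ℝ)) * eLpNorm (Δ φ : 𝓢(E, F)) 2 μ := by
  let b := stdOrthonormalBasis ℝ E
  set c := ENNReal.ofReal (2 / (finrank ℝ E - 2 : ℝ))
  have hsupp (j) : HasCompactSupport (∂_{b j} φ : 𝓢(E, F)) := by
    have h : ⇑(∂_{b j} φ : 𝓢(E, F)) = fun x => fderiv ℝ φ x (b j) :=
      funext (SchwartzMap.lineDerivOp_apply_eq_fderiv (b j) φ)
    exact h ▸ hc.fderiv_apply ℝ (b j)
  have hhardy (j) : eLpNorm (fun x => ‖x‖⁻¹ • ∂_{b j} φ x) 2 μ ^ 2 ≤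
      c ^ 2 * ∑ i, eLpNorm (∂_{b i} (∂_{b j} φ) : 𝓢(E, F)) 2 μ ^ 2 := by
    calc eLpNorm (fun x => ‖x‖⁻¹ • ∂_{b j} φ x) 2 μ ^ 2
        ≤ (c * eLpNorm (fderiv ℝ (∂_{b j} φ : 𝓢(E, F))) 2 μ) ^ 2 := by
          gcongr
          exact hardy_inequality hE ((∂_{b j} φ).smooth 1) (hsupp j)
      _ ≤ c ^ 2 * ∑ i, eLpNorm (∂_{b i} (∂_{b j} φ) : 𝓢(E, F)) 2 μ ^ 2 := by
          rw [mul_pow]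
          gcongr
          refine eLpNorm_two_sq_le_sum (fun i => (SchwartzMap.memLp _ 2 μ).1) fun x => ?_
          simp only [SchwartzMap.lineDerivOp_apply_eq_fderiv (b _) (∂_{b j} φ)]
          exact opNorm_sq_le_sum b _
  rw [← ENNReal.pow_le_pow_left_iff two_ne_zero, mul_pow, ← sum_eLpNorm_hessian_sq b]
  calc eLpNorm (fun x => (‖x‖ ^ 2)⁻¹ • fderiv ℝ φ x x) 2 μ ^ 2
      ≤ ∑ j, eLpNorm (fun x => ‖x‖⁻¹ • ∂_{b j} φ x) 2 μ ^ 2 :=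
        eLpNorm_two_sq_le_sum (fun j => (continuous_norm.measurable.inv.aestronglyMeasurable).smul
          (SchwartzMap.memLp _ 2 μ).1) (norm_inv_norm_sq_smul_fderiv_apply_self_sq_le b φ)
    _ ≤ ∑ j, c ^ 2 * ∑ i, eLpNorm (∂_{b i} (∂_{b j} φ) : 𝓢(E, F)) 2 μ ^ 2 :=
        Finset.sum_le_sum fun j _ => hhardy j
    _ = c ^ 2 * ∑ ij : _ × _, eLpNorm (∂_{b ij.1} (∂_{b ij.2} φ) : 𝓢(E, F)) 2 μ ^ 2 := by
        rw [← Finset.mul_sum, Fintype.sum_prod_type_right]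

end Hessian

section OrthonormalBasis

variable {n : ℕ} {E F G : Type*} [NormedAddCommGroup E] [InnerProductSpace ℝ E]
  [NormedAddCommGroup F] [InnerProductSpace ℝ F] [NormedAddCommGroup G] [NormedSpace ℝ G]

theorem exists_orthonormalBasis_eq_cons (b : OrthonormalBasis (Fin n) ℝ E) (T : E →ₗᵢ[ℝ] F)
    {p : F} (hp : ‖p‖ = 1) (hTp : ∀ v, inner ℝ (T v) p = 0) (hF : finrank ℝ F = n + 1) :
    ∃ c : OrthonormalBasis (Fin (n + 1)) ℝ F, ⇑c = Fin.cons p fun i => T (b i) := by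
  have hv : Orthonormal ℝ (Fin.cons p fun i => T (b i) : Fin (n + 1) → F) := by
    rw [orthonormal_iff_ite]
    have hpT (v : E) : inner ℝ p (T v) = 0 := by rw [real_inner_comm, hTp]
    refine Fin.cases (Fin.cases ?_ fun j => ?_) fun i => Fin.cases ?_ fun j => ?_
    · simp [hp]
    · simp [hpT, (Fin.succ_ne_zero j).symm]
    · simp [hTp]
    · simp [b.inner_eq_ite]
  have hcard : Fintype.card (Fin (n + 1)) = finrank ℝ F := by simp [hF]
  exact ⟨(basisOfOrthonormalOfCardEqFinrank hv hcard).toOrthonormalBasis (by simpa using hv),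
    by simp⟩

theorem laplacian_eq_add_sum [FiniteDimensional ℝ F] (b : OrthonormalBasis (Fin n) ℝ E)
    (T : E →ₗᵢ[ℝ] F) {p : F} (hp : ‖p‖ = 1) (hTp : ∀ v, inner ℝ (T v) p = 0)
    (hF : finrank ℝ F = n + 1) (f : F → G) (x : F) :
    Δ f x = fderiv ℝ (fderiv ℝ f) x p p +
      ∑ i, fderiv ℝ (fderiv ℝ f) x (T (b i)) (T (b i)) := by
  obtain ⟨c, hc⟩ := exists_orthonormalBasis_eq_cons b T hp hTp hF
  simp [laplacian_eq_iteratedFDeriv_orthonormalBasis f c, iteratedFDeriv_two_apply, hc,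
    Fin.sum_univ_succ]

end OrthonormalBasis

section Stereographic

/-- The conformal factor of `param`, normalized to be `1` at the centre of the chart. -/
def conformalFactor (y : E2) : ℝ := 4 * (‖y‖ ^ 2 + 4)⁻¹

theorem conformalFactor_pos (y : E2) : 0 < conformalFactor y := by
  unfold conformalFactor
  positivity

theorem conformalFactor_zero : conformalFactor 0 = 1 := by norm_num [conformalFactor]

theorem conformalFactor_mul (y : E2) : conformalFactor y * (‖y‖ ^ 2 + 4) = 4 := by
  unfold conformalFactor
  field_simp

theorem contDiff_conformalFactor : ContDiff ℝ 2 conformalFactor :=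
  contDiff_const.mul (((contDiff_norm_sq ℝ).add contDiff_const).inv fun y => by positivity)

theorem hasFDerivAt_conformalFactor (y : E2) :
    HasFDerivAt conformalFactor (-(conformalFactor y ^ 2 / 2) • innerSL ℝ y) y := by
  have hne : ‖y‖ ^ 2 + 4 ≠ 0 := by positivity
  have hnorm := (hasStrictFDerivAt_norm_sq y).hasFDerivAt.add_const 4
  refine (((hasDerivAt_inv hne).comp_hasFDerivAt y hnorm).const_mul 4).congr_fderiv ?_
  ext v
  simp only [neg_smul, smul_neg, neg_apply, smul_apply, coe_innerSL_apply, nsmul_eq_mul,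
    Nat.cast_ofNat, smul_eq_mul, conformalFactor, neg_inj]
  field_simp
  ring

theorem chartAt_self (p : S2) : chartAt E2 p p = 0 := by
  have : Fact (finrank ℝ E3 = 2 + 1) := ⟨by simp⟩
  change stereographic' 2 (-p) p = 0
  simp only [stereographic', OpenPartialHomeomorph.coe_trans, Function.comp_apply,
    stereographic_neg_apply]
  exact map_zero (OrthonormalBasis.fromOrthogonalSpanSingleton 2
    (ne_zero_of_mem_unit_sphere (-p))).repr

/-- The isometry of the plane onto the tangent plane `p^⊥` which underlies the stereographic chart
centred at `p`. -/
def tangentIsometry (p : S2) : E2 →ₗᵢ[ℝ] E3 :=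
  haveI : Fact (finrank ℝ E3 = 2 + 1) := ⟨by simp⟩
  (Submodule.subtypeₗᵢ _).comp (OrthonormalBasis.fromOrthogonalSpanSingleton (𝕜 := ℝ) 2
    (ne_zero_of_mem_unit_sphere (-p))).repr.symm.toLinearIsometry

theorem inner_tangentIsometry (p : S2) (v : E2) : inner ℝ (tangentIsometry p v) (p : E3) = 0 := by
  have : Fact (finrank ℝ E3 = 2 + 1) := ⟨by simp⟩
  have h := Submodule.mem_orthogonal_singleton_iff_inner_left.1
    ((OrthonormalBasis.fromOrthogonalSpanSingleton (𝕜 := ℝ) 2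
      (ne_zero_of_mem_unit_sphere (-p))).repr.symm v).2
  exact neg_eq_zero.1 ((inner_neg_right _ _).symm.trans h)

theorem param_eq (p : S2) (y : E2) :
    (param p y : E3) = conformalFactor y • tangentIsometry p y +
      (2 * conformalFactor y - 1) • (p : E3) := by
  have : Fact (finrank ℝ E3 = 2 + 1) := ⟨by simp⟩
  have hne : ‖y‖ ^ 2 + 4 ≠ 0 := by positivity
  refine (stereographic'_symm_apply (n := 2) (-p) y).trans ?_
  change (‖tangentIsometry p y‖ ^ 2 + 4)⁻¹ • (4 : ℝ) • tangentIsometry p y +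
    (‖tangentIsometry p y‖ ^ 2 + 4)⁻¹ • (‖tangentIsometry p y‖ ^ 2 - 4) • (-(p : E3)) = _
  rw [LinearIsometry.norm_map, conformalFactor]
  match_scalars <;> field_simp
  ring

theorem param_zero (p : S2) : (param p 0 : E3) = p := by
  rw [param_eq, conformalFactor_zero]
  norm_num

theorem contDiff_param (p : S2) : ContDiff ℝ 2 fun y => (param p y : E3) := by
  simp only [param_eq]
  exact (contDiff_conformalFactor.smul (tangentIsometry p).contDiff).add
    (((contDiff_const.mul contDiff_conformalFactor).sub contDiff_const).smul contDiff_const)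

theorem fderiv_param_apply (p : S2) (y v : E2) :
    fderiv ℝ (fun z => (param p z : E3)) y v = conformalFactor y • tangentIsometry p v -
      (conformalFactor y ^ 2 / 2 * inner ℝ v y) • (tangentIsometry p y + (2 : ℝ) • (p : E3)) := by
  have hfactor := hasFDerivAt_conformalFactor y
  have h : HasFDerivAt (fun z => (param p z : E3)) _ y :=
    ((hfactor.smul (tangentIsometry p).toContinuousLinearMap.hasFDerivAt).add
      (((hfactor.const_mul 2).sub_const 1).smul_const (p : E3))).congr_of_eventuallyEq
      (.of_forall (param_eq p))
  rw [h.fderiv, real_inner_comm]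
  simp only [neg_smul, LinearIsometry.coe_toContinuousLinearMap, smul_neg, add_apply, smul_apply,
    ContinuousLinearMap.smulRight_apply, neg_apply, coe_innerSL_apply, smul_eq_mul, smul_add]
  module

theorem fderiv_param_zero_apply (p : S2) (v : E2) :
    fderiv ℝ (fun z => (param p z : E3)) 0 v = tangentIsometry p v := by
  simp [fderiv_param_apply, conformalFactor_zero]

theorem fderiv_fderiv_param_zero_apply (p : S2) (v w : E2) :
    fderiv ℝ (fderiv ℝ fun z => (param p z : E3)) 0 v w = -inner ℝ w v • (p : E3) := by
  rw [← fderiv_fderiv_apply_const (contDiff_param p).contDiffAt]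
  have hfactor := hasFDerivAt_conformalFactor 0
  have hcoeff := ((hfactor.pow 2).mul_const (1 / 2)).mul (innerSL ℝ w).hasFDerivAt
  have hvector := (tangentIsometry p).toContinuousLinearMap.hasFDerivAt.add_const
    (x := 0) ((2 : ℝ) • (p : E3))
  have h : HasFDerivAt (fun y => fderiv ℝ (fun z => (param p z : E3)) y w) _ 0 :=
    ((hfactor.smul_const (tangentIsometry p w)).sub (hcoeff.smul hvector)).congr_of_eventuallyEq
      (.of_forall fun y => (fderiv_param_apply p y w).trans (by simp [div_eq_mul_inv]))
  rw [h.fderiv]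
  simp only [conformalFactor_zero, one_pow, one_div, map_zero, smul_zero,
    ContinuousLinearMap.zero_smulRight, coe_innerSL_apply, Pi.mul_apply, one_mul, inner_zero_right,
    mul_zero, zero_smul, Nat.add_one_sub_one, nsmul_eq_mul, Nat.cast_ofNat, mul_one, add_zero,
    zero_add, zero_sub, neg_apply, ContinuousLinearMap.smulRight_apply, smul_apply, smul_eq_mul,
    neg_smul, neg_inj]
  module

theorem inner_fderiv_param (p : S2) (y v w : E2) :
    inner ℝ (fderiv ℝ (fun z => (param p z : E3)) y v)
      (fderiv ℝ (fun z => (param p z : E3)) y w) = conformalFactor y ^ 2 * inner ℝ v w := by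
  have horth (z : E2) : inner ℝ (p : E3) (tangentIsometry p z) = 0 := by
    rw [real_inner_comm, inner_tangentIsometry]
  have hp : inner ℝ (p : E3) (p : E3) = 1 := by simp
  simp only [fderiv_param_apply, inner_add_left, inner_add_right, inner_sub_left, inner_sub_right,
    real_inner_smul_left, real_inner_smul_right, inner_tangentIsometry, horth, hp,
    LinearIsometry.inner_map_map, real_inner_self_eq_norm_sq]
  rw [real_inner_comm y w]
  linear_combination
    (inner ℝ y w * inner ℝ v y * conformalFactor y ^ 3 / 4) * conformalFactor_mul y

theorem metricMatrix_eq (p : S2) (y : E2) :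
    metricMatrix p y = (conformalFactor y ^ 2) • (1 : Matrix (Fin 2) (Fin 2) ℝ) := by
  ext i j
  simp [metricMatrix, partialDeriv, inner_fderiv_param, EuclideanSpace.inner_single_left,
    Matrix.one_apply]

theorem laplaceBeltrami_eq_laplacian {u : S2 → ℂ} {p : S2}
    (hu : ContDiff ℝ 2 fun y => u (param p y)) :
    laplaceBeltrami u p = Δ (fun y => u (param p y)) 0 := by
  have hdet (y) : √(metricMatrix p y).det = conformalFactor y ^ 2 := by
    rw [metricMatrix_eq, Matrix.det_smul]
    simpa using Real.sqrt_sq (sq_nonneg (conformalFactor y))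
  have hinv (y) : (metricMatrix p y)⁻¹ = (conformalFactor y ^ 2)⁻¹ • 1 := by
    rw [metricMatrix_eq]
    refine Matrix.inv_eq_left_inv ?_
    rw [smul_mul_smul_comm, inv_mul_cancel₀ (pow_pos (conformalFactor_pos y) 2).ne', one_mul,
      one_smul]
  have hflux (i : Fin 2) (y : E2) : conformalFactor y ^ 2 •
      ∑ j, ((conformalFactor y ^ 2)⁻¹ • (1 : Matrix (Fin 2) (Fin 2) ℝ)) i j •
        partialDeriv j (fun z => u (param p z)) y = partialDeriv i (fun z => u (param p z)) y := by
    simp [Matrix.one_apply, (conformalFactor_pos y).ne']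
  simp only [laplaceBeltrami, chartAt_self, hdet, hinv, hflux, conformalFactor_zero, one_pow,
    inv_one, one_smul]
  simp only [partialDeriv, fderiv_fderiv_apply_const hu.contDiffAt,
    laplacian_eq_iteratedFDeriv_orthonormalBasis _ (EuclideanSpace.basisFun (Fin 2) ℝ),
    iteratedFDeriv_two_apply, EuclideanSpace.basisFun_apply, Matrix.cons_val_zero,
    Matrix.cons_val_one]

theorem fderiv_fderiv_comp_smul_param_zero_apply {φ : E3 → ℂ} (hφ : ContDiff ℝ 2 φ) (r : ℝ) (p : S2)
    (v : E2) :
    fderiv ℝ (fderiv ℝ fun y => φ (r • (param p y : E3))) 0 v v =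
      r ^ 2 • fderiv ℝ (fderiv ℝ φ) (r • (p : E3)) (tangentIsometry p v) (tangentIsometry p v) -
        (r * ‖v‖ ^ 2) • fderiv ℝ φ (r • (p : E3)) p := by
  have hparam := contDiff_param p
  have hfderiv : (fderiv ℝ fun y => r • (param p y : E3)) =
      fun y => r • fderiv ℝ (fun z => (param p z : E3)) y :=
    funext fun y => fderiv_fun_const_smul (hparam.differentiable two_ne_zero y) r
  rw [fderiv_fderiv_comp_apply hφ (hparam.const_smul r), hfderiv,
    fderiv_fun_const_smul ((hparam.fderiv_right (m := 1) le_rfl).differentiable one_ne_zero 0)]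
  simp only [smul_apply, fderiv_param_zero_apply, fderiv_fderiv_param_zero_apply, param_zero,
    real_inner_self_eq_norm_sq, map_smul]
  module

theorem laplaceBeltrami_comp_smul {φ : E3 → ℂ} (hφ : ContDiff ℝ 2 φ) (r : ℝ) (p : S2) :
    laplaceBeltrami (fun θ => φ (r • (θ : E3))) p =
      r ^ 2 • (Δ φ (r • (p : E3)) - fderiv ℝ (fderiv ℝ φ) (r • (p : E3)) p p) -
        (2 * r) • fderiv ℝ φ (r • (p : E3)) p := by
  let b := EuclideanSpace.basisFun (Fin 2) ℝ
  rw [laplaceBeltrami_eq_laplacian (hφ.comp ((contDiff_param p).const_smul r)),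
    laplacian_eq_iteratedFDeriv_orthonormalBasis _ b,
    laplacian_eq_add_sum b (tangentIsometry p) (by simp) (inner_tangentIsometry p) (by simp),
    add_sub_cancel_left]
  simp only [iteratedFDeriv_two_apply, Matrix.cons_val_zero, Matrix.cons_val_one,
    fderiv_fderiv_comp_smul_param_zero_apply hφ, b.norm_eq_one, Fin.sum_univ_two]
  module

theorem angular_eq {φ : E3 → ℂ} (hφ : ContDiff ℝ 2 φ) {x : E3} (hx : x ≠ 0) :
    angular φ x = Δ φ x - (‖x‖ ^ 2)⁻¹ • fderiv ℝ (fderiv ℝ φ) x x x -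
      (2 : ℝ) • (‖x‖ ^ 2)⁻¹ • fderiv ℝ φ x x := by
  have hr : ‖x‖ ≠ 0 := norm_ne_zero_iff.2 hx
  have hpolar : ‖x‖ • (direction x hx : E3) = x := smul_inv_smul₀ hr x
  rw [angular, dif_neg hx, laplaceBeltrami_comp_smul hφ, hpolar]
  simp only [direction, map_smul, smul_apply]
  match_scalars <;> field_simp

end Stereographic

section EulerOperator

variable {E F : Type*} [NormedAddCommGroup E] [NormedSpace ℝ E] [NormedAddCommGroup F]
  [NormedSpace ℝ F]

/-- The Euler operator `x · ∇ = r ∂ᵣ`. -/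
def eulerOp (f : E → F) (x : E) : F := fderiv ℝ f x x

theorem contDiff_eulerOp {f : E → F} {n : ℕ} (hf : ContDiff ℝ (n + 1) f) :
    ContDiff ℝ n (eulerOp f) :=
  (hf.fderiv_right le_rfl).clm_apply contDiff_id

theorem hasCompactSupport_eulerOp {f : E → F} (hc : HasCompactSupport f) :
    HasCompactSupport (eulerOp f) :=
  (hc.fderiv ℝ).mono fun x hx h0 => hx (by simp [eulerOp, h0])

theorem eulerOp_eulerOp {f : E → F} {x : E} (hf : ContDiffAt ℝ 2 f x) :
    eulerOp (eulerOp f) x = fderiv ℝ (fderiv ℝ f) x x x + eulerOp f x := by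
  have h := ((hf.fderiv_right le_rfl).differentiableAt one_ne_zero).hasFDerivAt.clm_apply
    (hasFDerivAt_id x)
  rw [eulerOp, HasFDerivAt.fderiv (f := eulerOp f) h]
  simp [eulerOp, add_comm]

theorem integral_eulerOp_mul [FiniteDimensional ℝ E] [MeasurableSpace E] [BorelSpace E]
    {μ : Measure E} [μ.IsAddHaarMeasure] {A : Type*} [NormedCommRing A] [NormedAlgebra ℝ A]
    {f g : E → A} (hf : ContDiff ℝ 1 f) (hg : ContDiff ℝ 1 g) (hc : HasCompactSupport g) :
    ∫ x, eulerOp f x * g x ∂μ = -∫ x, f x * (eulerOp g x + (finrank ℝ E : ℝ) • g x) ∂μ := by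
  have hleibniz (x : E) :
      eulerOp f x * g x = fderiv ℝ (fun y => f y * g y) x x - f x * eulerOp g x := by
    rw [fderiv_fun_mul (hf.differentiable one_ne_zero x) (hg.differentiable one_ne_zero x)]
    simp [eulerOp, mul_comm]
  have hfg : Integrable (fun x => f x * g x) μ :=
    (hf.continuous.mul hg.continuous).integrable_of_hasCompactSupport hc.mul_left
  have hg' : Continuous (eulerOp g) := (contDiff_eulerOp (n := 0) (by simpa using hg)).continuous
  have hfg' : Integrable (fun x => f x * eulerOp g x) μ :=
    (hf.continuous.mul hg').integrable_of_hasCompactSupport (hasCompactSupport_eulerOp hc).mul_left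
  simp only [hleibniz, mul_add, mul_smul_comm]
  rw [integral_sub (integrable_fderiv_apply_self (hf.mul hg) hc.mul_left) hfg',
    integral_fderiv_apply_self (hf.mul hg) hc.mul_left, integral_add hfg' (hfg.fun_smul _),
    integral_smul]
  module

end EulerOperator

section RadialPart

variable {E F : Type*} [NormedAddCommGroup E] [InnerProductSpace ℝ E] [NormedAddCommGroup F]
  [NormedSpace ℝ F]

theorem eulerOp_norm_sq_smul {f : E → F} {x : E} (hf : DifferentiableAt ℝ f x) :
    eulerOp (fun y => ‖y‖ ^ 2 • f y) x = ‖x‖ ^ 2 • (eulerOp f x + (2 : ℝ) • f x) := by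
  rw [eulerOp, ((hasStrictFDerivAt_norm_sq x).hasFDerivAt.fun_smul hf.hasFDerivAt).fderiv]
  simp only [add_apply, smul_apply, ContinuousLinearMap.smulRight_apply, coe_innerSL_apply,
    inner_self_eq_norm_sq_to_K, Real.ringHom_apply, nsmul_eq_mul, Nat.cast_ofNat, eulerOp, smul_add]
  module

theorem contDiff_inv_norm_sq_smul {f : E → F} {n : ℕ} (hf : ContDiff ℝ n f) (h0 : 0 ∉ tsupport f) :
    ContDiff ℝ n fun x => (‖x‖ ^ 2)⁻¹ • f x := by
  refine contDiff_iff_contDiffAt.2 fun x => ?_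
  rcases eq_or_ne x 0 with rfl | hx
  · refine contDiffAt_const (c := (0 : F)) |>.congr_of_eventuallyEq ?_
    filter_upwards [notMem_tsupport_iff_eventuallyEq.1 h0] with y hy
    simp [hy]
  · exact ((contDiff_norm_sq ℝ).contDiffAt.inv (by simpa using hx)).smul hf.contDiffAt

/-- The radial part `r⁻² ((r ∂ᵣ)² + (d - 2) r ∂ᵣ) = ∂ᵣ² + (d - 1) r⁻¹ ∂ᵣ` of the Laplacian in
dimension `d`. -/
def radialLaplacian (f : E → F) (x : E) : F :=
  (‖x‖ ^ 2)⁻¹ • (eulerOp (eulerOp f) x + (finrank ℝ E - 2 : ℝ) • eulerOp f x)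

theorem eulerOp_zero_right (f : E → F) : eulerOp f 0 = 0 := map_zero _

theorem radialLaplacian_norm_sq_smul {f : E → F} (hf : ContDiff ℝ 2 f) {x : E} (hx : x ≠ 0) :
    radialLaplacian (fun y => ‖y‖ ^ 2 • f y) x =
      eulerOp (fun y => eulerOp f y + (2 : ℝ) • f y) x +
        (finrank ℝ E : ℝ) • (eulerOp f x + (2 : ℝ) • f x) := by
  have heuler : eulerOp (fun y => ‖y‖ ^ 2 • f y) =
      fun y => ‖y‖ ^ 2 • (eulerOp f y + (2 : ℝ) • f y) :=
    funext fun y => eulerOp_norm_sq_smul (hf.differentiable two_ne_zero y)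
  have hdiff : Differentiable ℝ fun y => eulerOp f y + (2 : ℝ) • f y :=
    ((contDiff_eulerOp (n := 1) hf).differentiable one_ne_zero).add
      ((hf.differentiable two_ne_zero).const_smul 2)
  rw [radialLaplacian, heuler, eulerOp_norm_sq_smul (hdiff x), smul_comm (_ - 2 : ℝ), ← smul_add,
    inv_smul_smul₀ (by simpa using hx)]
  module

variable [FiniteDimensional ℝ E] [MeasurableSpace E] [BorelSpace E] {μ : Measure E}
  [μ.IsAddHaarMeasure] {A : Type*} [NormedCommRing A] [NormedAlgebra ℝ A]

theorem integral_eulerOp_eulerOp_add_smul_mul {f ψ : E → A} (hf : ContDiff ℝ 2 f)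
    (hψ : ContDiff ℝ 1 ψ) (hc : HasCompactSupport ψ) (c : ℝ) :
    ∫ x, (eulerOp (eulerOp f) x + c • eulerOp f x) * ψ x ∂μ =
      -∫ x, eulerOp f x * (eulerOp ψ x + (finrank ℝ E - c) • ψ x) ∂μ := by
  have hRf : ContDiff ℝ 1 (eulerOp f) := contDiff_eulerOp (n := 1) hf
  have hint {g h : E → A} (hg : Continuous g) (hh : Continuous h) (hhc : HasCompactSupport h) :
      Integrable (fun x => g x * h x) μ :=
    (hg.mul hh).integrable_of_hasCompactSupport hhc.mul_left
  have hRRfψ := hint (contDiff_eulerOp (n := 0) hRf).continuous hψ.continuous hc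
  have hRfψ := hint hRf.continuous hψ.continuous hc
  have hRfRψ := hint hRf.continuous (contDiff_eulerOp (n := 0) hψ).continuous
    (hasCompactSupport_eulerOp hc)
  have hparts := integral_eulerOp_mul (μ := μ) hRf hψ hc
  simp only [add_mul, mul_add, mul_smul_comm, smul_mul_assoc] at hparts ⊢
  rw [integral_add hRRfψ (hRfψ.fun_smul c), integral_add hRfRψ (hRfψ.fun_smul _), hparts,
    integral_add hRfRψ (hRfψ.fun_smul _)]
  simp only [integral_smul]
  module

theorem integral_radialLaplacian_mul {f φ : E → A} (hf : ContDiff ℝ 2 f) (hφ : ContDiff ℝ 2 φ)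
    (hc : HasCompactSupport φ) (h0 : 0 ∉ tsupport φ) :
    ∫ x, radialLaplacian f x * φ x ∂μ = ∫ x, f x * radialLaplacian φ x ∂μ := by
  obtain ⟨ψ, hψ_apply⟩ : ∃ ψ : E → A, ∀ x, ψ x = (‖x‖ ^ 2)⁻¹ • φ x := ⟨_, fun _ => rfl⟩
  have hψ : ContDiff ℝ 2 ψ := by
    rw [funext hψ_apply]
    exact contDiff_inv_norm_sq_smul (n := 2) hφ h0
  have hψc : HasCompactSupport ψ :=
    hc.mono fun x hx h0 => hx (by simp [hψ_apply, h0])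
  have hφ_eq : φ = fun x => ‖x‖ ^ 2 • ψ x := by
    funext x
    rcases eq_or_ne x 0 with rfl | hx
    · simp [image_eq_zero_of_notMem_tsupport h0]
    · rw [hψ_apply, smul_inv_smul₀ (by simpa using hx)]
  obtain ⟨w, hw_apply⟩ : ∃ w : E → A, ∀ x, w x = eulerOp ψ x + (2 : ℝ) • ψ x := ⟨_, fun _ => rfl⟩
  have hw : ContDiff ℝ 1 w := by
    rw [funext hw_apply]
    exact (contDiff_eulerOp (n := 1) hψ).add ((hψ.of_le one_le_two).const_smul 2)
  have hwc : HasCompactSupport w := by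
    rw [funext hw_apply]
    exact (hasCompactSupport_eulerOp hψc).add
      (hψc.mono fun x hx h0 => hx (by simp [h0]))
  have hradial (x : E) : radialLaplacian φ x = eulerOp w x + (finrank ℝ E : ℝ) • w x := by
    rcases eq_or_ne x 0 with rfl | hx
    · simp [radialLaplacian, eulerOp_zero_right, hw_apply, hψ_apply]
    · rw [hφ_eq, radialLaplacian_norm_sq_smul hψ hx, funext hw_apply]
  calc ∫ x, radialLaplacian f x * φ x ∂μ
      = ∫ x, (eulerOp (eulerOp f) x + (finrank ℝ E - 2 : ℝ) • eulerOp f x) * ψ x ∂μ := by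
        simp only [radialLaplacian, hψ_apply, mul_smul_comm, smul_mul_assoc]
    _ = -∫ x, eulerOp f x * w x ∂μ := by
        simp only [integral_eulerOp_eulerOp_add_smul_mul hf (hψ.of_le one_le_two) hψc,
          sub_sub_cancel, hw_apply]
    _ = ∫ x, f x * radialLaplacian φ x ∂μ := by
        simp only [integral_eulerOp_mul (hf.of_le one_le_two) hw hwc, neg_neg, hradial]

end RadialPart

section RadialEstimate

theorem radialLaplacian_eq {E F : Type*} [NormedAddCommGroup E] [InnerProductSpace ℝ E]
    [NormedAddCommGroup F] [NormedSpace ℝ F] {f : E → F} {x : E} (hf : ContDiffAt ℝ 2 f x) :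
    radialLaplacian f x = (‖x‖ ^ 2)⁻¹ • fderiv ℝ (fderiv ℝ f) x x x +
      (finrank ℝ E - 1 : ℝ) • (‖x‖ ^ 2)⁻¹ • fderiv ℝ f x x := by
  rw [radialLaplacian, eulerOp_eulerOp hf, eulerOp]
  module

variable {E F : Type*} [NormedAddCommGroup E] [InnerProductSpace ℝ E] [FiniteDimensional ℝ E]
  [MeasurableSpace E] [BorelSpace E] [NormedAddCommGroup F] [InnerProductSpace ℝ F]
  {μ : Measure E}

theorem aestronglyMeasurable_inv_norm_sq_smul {f : E → F} (hf : Continuous f) :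
    AEStronglyMeasurable (fun x => (‖x‖ ^ 2)⁻¹ • f x) μ :=
  (measurable_norm.pow_const 2).inv.aestronglyMeasurable.smul hf.aestronglyMeasurable

variable {φ : 𝓢(E, F)}

theorem aestronglyMeasurable_radialLaplacian : AEStronglyMeasurable (radialLaplacian φ) μ :=
  aestronglyMeasurable_inv_norm_sq_smul <|
    (contDiff_eulerOp (n := 0) (contDiff_eulerOp (n := 1) (φ.smooth 2))).continuous.add
      ((contDiff_eulerOp (n := 0) (φ.smooth 1)).continuous.const_smul _)

variable [μ.IsAddHaarMeasure]

theorem eLpNorm_radialLaplacian_le (hE : 2 < finrank ℝ E) (hc : HasCompactSupport φ) :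
    eLpNorm (radialLaplacian φ) 2 μ ≤
      ENNReal.ofReal (1 + (finrank ℝ E - 1) * (2 / (finrank ℝ E - 2))) *
        eLpNorm (Δ φ : 𝓢(E, F)) 2 μ := by
  have hd : (2 : ℝ) < finrank ℝ E := by exact_mod_cast hE
  have hfderiv : Continuous (fderiv ℝ φ) := (φ.smooth 1).continuous_fderiv one_ne_zero
  have hhessian : Continuous (fderiv ℝ (fderiv ℝ φ)) :=
    ((φ.smooth 2).fderiv_right le_rfl).continuous_fderiv one_ne_zero
  have hmul : 0 ≤ (finrank ℝ E - 1 : ℝ) := by linarith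
  have hdiv : 0 ≤ (2 / (finrank ℝ E - 2) : ℝ) := div_nonneg zero_le_two (by linarith)
  calc eLpNorm (radialLaplacian φ) 2 μ
      = eLpNorm ((fun x => (‖x‖ ^ 2)⁻¹ • fderiv ℝ (fderiv ℝ φ) x x x) +
          (finrank ℝ E - 1 : ℝ) • fun x => (‖x‖ ^ 2)⁻¹ • fderiv ℝ φ x x) 2 μ :=
        congrArg (eLpNorm · 2 μ) <| funext fun x => radialLaplacian_eq (φ.smooth 2).contDiffAt
    _ ≤ eLpNorm (fun x => (‖x‖ ^ 2)⁻¹ • fderiv ℝ (fderiv ℝ φ) x x x) 2 μ +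
          eLpNorm ((finrank ℝ E - 1 : ℝ) • fun x => (‖x‖ ^ 2)⁻¹ • fderiv ℝ φ x x) 2 μ :=
        eLpNorm_add_le
          (aestronglyMeasurable_inv_norm_sq_smul
            ((hhessian.clm_apply continuous_id).clm_apply continuous_id))
          ((aestronglyMeasurable_inv_norm_sq_smul (hfderiv.clm_apply continuous_id)).const_smul _)
          one_le_two
    _ ≤ eLpNorm (Δ φ : 𝓢(E, F)) 2 μ + ENNReal.ofReal (finrank ℝ E - 1) *
          (ENNReal.ofReal (2 / (finrank ℝ E - 2)) * eLpNorm (Δ φ : 𝓢(E, F)) 2 μ) := by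
        rw [eLpNorm_const_smul, Real.enorm_of_nonneg hmul]
        gcongr
        · exact eLpNorm_inv_norm_sq_smul_fderiv_fderiv_apply_self_le φ
        · exact eLpNorm_inv_norm_sq_smul_fderiv_apply_self_le hE hc
    _ = _ := by
        rw [ENNReal.ofReal_add zero_le_one (mul_nonneg hmul hdiv), ENNReal.ofReal_mul hmul,
          ENNReal.ofReal_one, add_mul, one_mul, mul_assoc]

theorem memLp_radialLaplacian (hE : 2 < finrank ℝ E) (hc : HasCompactSupport φ) :
    MemLp (radialLaplacian φ) 2 μ :=
  ⟨aestronglyMeasurable_radialLaplacian, (eLpNorm_radialLaplacian_le hE hc).trans_lt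
    (ENNReal.mul_lt_top ENNReal.ofReal_lt_top ((Δ φ : 𝓢(E, F)).memLp 2 μ).2)⟩

end RadialEstimate

section Angular

theorem angular_eq_sub_radialLaplacian {φ : E3 → ℂ} (hφ : ContDiff ℝ 2 φ) {x : E3} (hx : x ≠ 0) :
    angular φ x = Δ φ x - radialLaplacian φ x := by
  rw [angular_eq hφ hx, radialLaplacian_eq hφ.contDiffAt, finrank_euclideanSpace_fin]
  module

variable (φ : 𝓢(E3, ℂ))

theorem angular_ae_eq_sub_radialLaplacian :
    angular φ =ᵐ[volume] ⇑(Δ φ : 𝓢(E3, ℂ)) - radialLaplacian φ := by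
  filter_upwards [Measure.ae_ne volume 0] with x hx
  rw [angular_eq_sub_radialLaplacian (φ.smooth 2) hx, Pi.sub_apply, SchwartzMap.laplacian_apply]

variable {φ}

theorem memLp_angular (hc : HasCompactSupport φ) : MemLp (angular φ) 2 :=
  (memLp_congr_ae (angular_ae_eq_sub_radialLaplacian φ)).2
    (((Δ φ : 𝓢(E3, ℂ)).memLp 2 volume).sub (memLp_radialLaplacian (by simp) hc))

theorem eLpNorm_angular_le (hc : HasCompactSupport φ) :
    eLpNorm (angular φ) 2 volume ≤ 6 * eLpNorm (Δ φ : 𝓢(E3, ℂ)) 2 volume := by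
  have hconst : (1 + (finrank ℝ E3 - 1) * (2 / (finrank ℝ E3 - 2)) : ℝ) = 5 := by
    rw [finrank_euclideanSpace_fin]
    norm_num
  calc eLpNorm (angular φ) 2 volume
      ≤ eLpNorm (Δ φ : 𝓢(E3, ℂ)) 2 volume + eLpNorm (radialLaplacian φ) 2 volume := by
        rw [eLpNorm_congr_ae (angular_ae_eq_sub_radialLaplacian φ)]
        exact eLpNorm_sub_le ((Δ φ : 𝓢(E3, ℂ)).memLp 2 volume).1
          aestronglyMeasurable_radialLaplacian one_le_two
    _ ≤ eLpNorm (Δ φ : 𝓢(E3, ℂ)) 2 volume + 5 * eLpNorm (Δ φ : 𝓢(E3, ℂ)) 2 volume := by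
        gcongr
        simpa only [hconst, ENNReal.ofReal_ofNat] using
          eLpNorm_radialLaplacian_le (μ := volume) (by simp) hc
    _ = 6 * eLpNorm (Δ φ : 𝓢(E3, ℂ)) 2 volume := by ring

theorem integral_angular_mul {f : 𝓢(E3, ℂ)} (hf : HasCompactSupport f) (hφ : HasCompactSupport φ)
    (h0 : 0 ∉ tsupport φ) : ∫ x, angular f x * φ x = ∫ x, f x * angular φ x := by
  have hradial {u : 𝓢(E3, ℂ)} (hu : HasCompactSupport u) : MemLp (radialLaplacian u) 2 volume :=
    memLp_radialLaplacian (by simp) hu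
  have hint {u v : E3 → ℂ} (hu : MemLp u 2 volume) (hv : MemLp v 2 volume) :
      Integrable (fun x => u x * v x) := hu.integrable_mul hv
  calc ∫ x, angular f x * φ x
      = ∫ x, (Δ f : 𝓢(E3, ℂ)) x * φ x - radialLaplacian f x * φ x := by
        refine integral_congr_ae ?_
        filter_upwards [angular_ae_eq_sub_radialLaplacian f] with x hx
        rw [hx, Pi.sub_apply, sub_mul]
    _ = ∫ x, f x * (Δ φ : 𝓢(E3, ℂ)) x - f x * radialLaplacian φ x := by
        rw [integral_sub (hint ((Δ f).memLp 2) (φ.memLp 2)) (hint (hradial hf) (φ.memLp 2)),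
          integral_sub (hint (f.memLp 2) ((Δ φ).memLp 2)) (hint (f.memLp 2) (hradial hφ)),
          SchwartzMap.integral_mul_laplacian_right_eq_left,
          integral_radialLaplacian_mul (f.smooth 2) (φ.smooth 2) hφ h0]
    _ = ∫ x, f x * angular φ x := by
        refine integral_congr_ae ?_
        filter_upwards [angular_ae_eq_sub_radialLaplacian φ] with x hx
        rw [hx, Pi.sub_apply, mul_sub]

end Angular

section Cutoff

variable {E F : Type*} [NormedAddCommGroup E] [NormedSpace ℝ E]
  [NormedAddCommGroup F] [NormedSpace ℝ F]

theorem seminorm_smulLeftCLM_comp_smul_le {g : E → ℝ} (hg : g.HasTemperateGrowth) {C : ℕ → ℝ}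
    (hC : ∀ i x, ‖iteratedFDeriv ℝ i g x‖ ≤ C i * ‖x‖) (f : 𝓢(E, F)) (k n : ℕ) {ε : ℝ}
    (h0 : 0 ≤ ε) (h1 : ε ≤ 1) :
    SchwartzMap.seminorm ℝ k n (SchwartzMap.smulLeftCLM F (fun x => g (ε • x)) f) ≤
      ε * ∑ i ∈ Finset.range (n + 1),
        n.choose i * |C i| * SchwartzMap.seminorm ℝ (k + 1) (n - i) f := by
  have hgε : (fun x => g (ε • x)).HasTemperateGrowth := by fun_prop
  have hderiv (i : ℕ) (x : E) :
      ‖iteratedFDeriv ℝ i (fun y => g (ε • y)) x‖ ≤ ε * (|C i| * ‖x‖) := by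
    rw [iteratedFDeriv_comp_const_smul ε (hg.1.of_le (mod_cast le_top)), norm_smul, norm_pow,
      Real.norm_of_nonneg h0]
    calc ε ^ i * ‖iteratedFDeriv ℝ i g (ε • x)‖ ≤ 1 * (|C i| * ‖ε • x‖) := by
          gcongr
          · exact pow_le_one₀ h0 h1
          · exact (hC i _).trans (by gcongr; exact le_abs_self _)
      _ = ε * (|C i| * ‖x‖) := by
          rw [norm_smul, Real.norm_of_nonneg h0]
          ring
  refine SchwartzMap.seminorm_le_bound ℝ k n _ (by positivity) fun x => ?_
  have happly : ⇑(SchwartzMap.smulLeftCLM F (fun x => g (ε • x)) f) =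
      fun x => g (ε • x) • f x :=
    funext (SchwartzMap.smulLeftCLM_apply_apply hgε f)
  calc ‖x‖ ^ k * ‖iteratedFDeriv ℝ n (SchwartzMap.smulLeftCLM F (fun x => g (ε • x)) f) x‖
      ≤ ‖x‖ ^ k * ∑ i ∈ Finset.range (n + 1), n.choose i *
          ‖iteratedFDeriv ℝ i (fun y => g (ε • y)) x‖ * ‖iteratedFDeriv ℝ (n - i) f x‖ := by
        rw [happly]
        gcongr
        exact norm_iteratedFDeriv_smul_le hgε.1 (f.smooth _) x (mod_cast le_top)
    _ ≤ ‖x‖ ^ k * ∑ i ∈ Finset.range (n + 1), n.choose i * (ε * (|C i| * ‖x‖)) *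
          ‖iteratedFDeriv ℝ (n - i) f x‖ := by
        gcongr with i
        exact hderiv i x
    _ = ε * ∑ i ∈ Finset.range (n + 1), n.choose i * |C i| *
          (‖x‖ ^ (k + 1) * ‖iteratedFDeriv ℝ (n - i) f x‖) := by
        rw [Finset.mul_sum, Finset.mul_sum]
        exact Finset.sum_congr rfl fun i _ => by ring
    _ ≤ _ := by
        gcongr with i
        exact SchwartzMap.le_seminorm ℝ (k + 1) (n - i) f x

variable [FiniteDimensional ℝ E] [HasContDiffBump E]

theorem exists_norm_iteratedFDeriv_one_sub_contDiffBump_le (b : ContDiffBump (0 : E)) (i : ℕ) :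
    ∃ C, ∀ x, ‖iteratedFDeriv ℝ i (fun y => 1 - b y) x‖ ≤ C * ‖x‖ := by
  obtain ⟨C, hC⟩ := (b.hasCompactSupport.iteratedFDeriv (𝕜 := ℝ) i).exists_bound_of_continuous
    (b.contDiff.continuous_iteratedFDeriv le_rfl)
  have hconst (x : E) : ‖iteratedFDeriv ℝ i (fun _ : E => (1 : ℝ)) x‖ ≤ 1 := by
    cases i with
    | zero => simp
    | succ i => simp [iteratedFDeriv_succ_const]
  have hbound (x : E) : ‖iteratedFDeriv ℝ i (fun y => 1 - b y) x‖ ≤ 1 + C := by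
    rw [fun_iteratedFDeriv_sub_apply contDiffAt_const b.contDiff.contDiffAt]
    exact (norm_sub_le _ _).trans (add_le_add (hconst x) (hC x))
  refine ⟨(1 + C) / b.rIn, fun x => ?_⟩
  have h0 : 0 ≤ 1 + C := (norm_nonneg _).trans (hbound 0)
  rcases lt_or_ge ‖x‖ b.rIn with hx | hx
  · have hzero : (fun y => 1 - b y) =ᶠ[𝓝 x] 0 := by
      filter_upwards [b.eventuallyEq_one_of_mem_ball (mem_ball_zero_iff.2 hx)] with y hy
      rw [hy, Pi.one_apply, sub_self, Pi.zero_apply]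
    rw [(hzero.iteratedFDeriv ℝ i).eq_of_nhds, iteratedFDeriv_zero]
    simpa using mul_nonneg (div_nonneg h0 b.rIn_pos.le) (norm_nonneg x)
  · calc _ ≤ 1 + C := hbound x
      _ = (1 + C) / b.rIn * b.rIn := (div_mul_cancel₀ _ b.rIn_pos.ne').symm
      _ ≤ (1 + C) / b.rIn * ‖x‖ := by gcongr; exact div_nonneg h0 b.rIn_pos.le

theorem dense_hasCompactSupport : Dense {f : 𝓢(E, F) | HasCompactSupport f} := by
  intro f
  let b : ContDiffBump (0 : E) := ⟨1, 2, one_pos, one_lt_two⟩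
  have hb : (⇑b).HasTemperateGrowth := b.hasCompactSupport.hasTemperateGrowth b.contDiff
  choose C hC using exists_norm_iteratedFDeriv_one_sub_contDiffBump_le b
  let approx (ε : ℝ) : 𝓢(E, F) := SchwartzMap.smulLeftCLM F (fun x => b (ε • x)) f
  have hsub (ε : ℝ) :
      f - approx ε = SchwartzMap.smulLeftCLM F (fun x => 1 - b (ε • x)) f := by
    have h1 : (fun x => b (ε • x)).HasTemperateGrowth := by fun_prop
    have h2 : (fun x => 1 - b (ε • x)).HasTemperateGrowth := by fun_prop
    ext x
    rw [sub_apply, SchwartzMap.smulLeftCLM_apply_apply h1,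
      SchwartzMap.smulLeftCLM_apply_apply h2, sub_smul, one_smul]
  have happrox : Tendsto approx (𝓝[>] 0) (𝓝 f) := by
    refine ((schwartz_withSeminorms ℝ E F).tendsto_nhds approx f).2 fun ⟨k, n⟩ δ hδ => ?_
    set M := ∑ i ∈ Finset.range (n + 1),
      n.choose i * |C i| * SchwartzMap.seminorm ℝ (k + 1) (n - i) f
    have hlim : Tendsto (fun ε : ℝ => ε * M) (𝓝[>] 0) (𝓝 0) :=
      ((continuous_mul_const M).tendsto' 0 0 (zero_mul M)).mono_left nhdsWithin_le_nhds
    filter_upwards [hlim.eventually_lt_const hδ, Ioc_mem_nhdsGT one_pos] with ε hε hmem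
    rw [map_sub_rev, hsub]
    exact (seminorm_smulLeftCLM_comp_smul_le (by fun_prop) hC f k n hmem.1.le hmem.2).trans_lt hε
  refine mem_closure_of_tendsto happrox ?_
  filter_upwards [self_mem_nhdsWithin] with ε hε
  exact (b.hasCompactSupport.comp_smul (Set.mem_Ioi.1 hε).ne').of_isClosed_subset
    (isClosed_tsupport _)
    ((SchwartzMap.tsupport_smulLeftCLM_subset _ f).trans Set.inter_subset_right)

end Cutoff

section Density

open FourierTransform
open scoped Real

theorem norm_le_of_eq_fourierMultiplierCLM {E F : Type*} [NormedAddCommGroup E]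
    [InnerProductSpace ℝ E] [FiniteDimensional ℝ E] [MeasurableSpace E] [BorelSpace E]
    [NormedAddCommGroup F] [InnerProductSpace ℂ F] [CompleteSpace F] {g : E → ℂ}
    (hg : g.HasTemperateGrowth) {C : ℝ} (hC : ∀ x, ‖g x‖ ≤ C) {u v : Lp F 2 (volume : Measure E)}
    (h : (v : 𝓢'(E, F)) = fourierMultiplierCLM F g (u : 𝓢'(E, F))) : ‖v‖ ≤ C * ‖u‖ := by
  have hC0 : 0 ≤ C := (norm_nonneg _).trans (hC 0)
  have hmem : MemLp g ∞ (volume : Measure E) :=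
    memLp_top_of_bound hg.1.continuous.aestronglyMeasurable C (Eventually.of_forall hC)
  have hnorm : ‖hmem.toLp g‖ ≤ C := by
    rw [Lp.norm_toLp, eLpNorm_exponent_top]
    exact ENNReal.toReal_le_of_le_ofReal hC0
      (eLpNormEssSup_le_of_ae_bound (Eventually.of_forall hC))
  have hv : v = 𝓕⁻ (hmem.toLp g • 𝓕 u : Lp F 2 (volume : Measure E)) := by
    apply LinearMap.ker_eq_bot.1 (Lp.ker_toTemperedDistributionCLM_eq_bot (F := F) (p := 2))
    simp only [ContinuousLinearMap.coe_coe, Lp.toTemperedDistributionCLM_apply]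
    rw [h, ← Lp.fourierInv_toTemperedDistribution_eq, Lp.toTemperedDistribution_smul_eq hg,
      ← Lp.fourier_toTemperedDistribution_eq, fourierMultiplierCLM_apply]
  calc ‖v‖ = ‖(hmem.toLp g • 𝓕 u : Lp F 2 (volume : Measure E))‖ := by
        rw [hv, ← Lp.norm_fourier_eq, fourier_fourierInv_eq]
    _ ≤ ‖hmem.toLp g‖ * ‖𝓕 u‖ := Lp.norm_smul_le _ _
    _ ≤ C * ‖u‖ := by
        rw [Lp.norm_fourier_eq]
        gcongr

namespace H2

theorem toL2_injective : Function.Injective toL2 := Subtype.val_injective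

theorem lap_spec (f : H2) : Δ (f.toL2 : 𝓢'(E3, ℂ)) = (lap f : 𝓢'(E3, ℂ)) := weakLaplacian_spec f

theorem norm_lap_le (f : H2) : ‖lap f‖ ≤ ‖f‖ := by
  rw [← norm_neg]
  exact WithLp.norm_fst_le L2 (graph f)

theorem norm_toL2_le (f : H2) : ‖toL2 f‖ ≤ ‖f‖ := WithLp.norm_snd_le L2 (graph f)

theorem continuous_toL2 : Continuous toL2 :=
  (toL2.mkContinuous 1 fun f => (norm_toL2_le f).trans_eq (one_mul _).symm).continuous

theorem norm_le_norm_lap_add_norm_toL2 (f : H2) : ‖f‖ ≤ ‖lap f‖ + ‖toL2 f‖ := by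
  rw [norm_eq, norm_neg, Real.sqrt_le_left (by positivity)]
  nlinarith [norm_nonneg (lap f), norm_nonneg (toL2 f)]

theorem toLp_mem_sobolevH2 (φ : 𝓢(E3, ℂ)) : φ.toLp 2 volume ∈ sobolevH2 := by
  have h : MemSobolev 2 2 ((φ.toLp 2 : L2) : 𝓢'(E3, ℂ)) := by
    rw [Lp.toTemperedDistribution_toLp_eq]
    exact φ.memSobolev
  exact h

/-- The inclusion of the Schwartz space into `H²`. -/
def ofSchwartz : 𝓢(E3, ℂ) →ₗ[ℂ] H2 :=
  (SchwartzMap.toLpCLM ℂ ℂ 2 (volume : Measure E3)).toLinearMap.codRestrict sobolevH2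
    toLp_mem_sobolevH2

theorem toL2_ofSchwartz (φ : 𝓢(E3, ℂ)) : toL2 (ofSchwartz φ) = φ.toLp 2 := rfl

theorem lap_ofSchwartz (φ : 𝓢(E3, ℂ)) : lap (ofSchwartz φ) = (Δ φ).toLp 2 := by
  apply toTemperedDistribution_injective
  simp only [Lp.toTemperedDistributionCLM_apply]
  rw [← lap_spec, toL2_ofSchwartz, Lp.toTemperedDistribution_toLp_eq φ,
    Lp.toTemperedDistribution_toLp_eq (Δ φ)]
  exact TemperedDistribution.laplacian_toTemperedDistributionCLM_eq φ

theorem continuous_ofSchwartz : Continuous ofSchwartz := by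
  have hgraph (φ : 𝓢(E3, ℂ)) : graph (ofSchwartz φ) =
      WithLp.toLp 2 (-(Δ φ : 𝓢(E3, ℂ)).toLp 2, φ.toLp 2) := by
    rw [← lap_ofSchwartz, ← toL2_ofSchwartz]
    rfl
  refine continuous_induced_rng.2 (Continuous.congr ?_ fun φ => (hgraph φ).symm)
  exact (WithLp.prod_continuous_toLp 2 L2 L2).comp
    (((SchwartzMap.toLpCLM ℂ ℂ 2 volume).continuous.comp
      (LineDeriv.laplacianCLM ℝ E3 𝓢(E3, ℂ)).continuous).neg.prodMk
      (SchwartzMap.toLpCLM ℂ ℂ 2 volume).continuous)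

theorem norm_le_of_besselPotential_eq {u : H2} {h : L2}
    (hu : besselPotential E3 ℂ 2 (u.toL2 : 𝓢'(E3, ℂ)) = (h : 𝓢'(E3, ℂ))) :
    ‖u‖ ≤ ((2 * π) ^ 2 + 1) * ‖h‖ := by
  let m (x : E3) : ℂ := ((1 + ‖x‖ ^ 2) ^ ((-2 : ℝ) / 2) : ℝ)
  let q (x : E3) : ℂ := (‖x‖ ^ 2 : ℝ)
  have hm : m.HasTemperateGrowth := by fun_prop
  have hq : q.HasTemperateGrowth := by fun_prop
  have norm_m (x : E3) : ‖m x‖ = (1 + ‖x‖ ^ 2)⁻¹ := by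
    rw [Complex.norm_real, Real.norm_of_nonneg (by positivity), neg_div, div_self two_ne_zero,
      Real.rpow_neg_one]
  have hu' : (u.toL2 : 𝓢'(E3, ℂ)) = fourierMultiplierCLM ℂ m (h : 𝓢'(E3, ℂ)) :=
    ((besselPotential_neg_apply_eq_iff 2 _ _).2 hu).symm
  have hlap : (((-((2 * π) ^ 2 : ℝ) : ℂ)⁻¹ • lap u : L2) : 𝓢'(E3, ℂ)) =
      fourierMultiplierCLM ℂ (m * q) (h : 𝓢'(E3, ℂ)) := by
    rw [← Lp.toTemperedDistributionCLM_apply, map_smul, Lp.toTemperedDistributionCLM_apply,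
      ← lap_spec, hu', TemperedDistribution.laplacian_eq_fourierMultiplierCLM,
      TemperedDistribution.fourierMultiplierCLM_fourierMultiplierCLM_apply hm hq,
      ← Complex.coe_smul, smul_smul, Complex.ofReal_neg, inv_mul_cancel₀ (by simp), one_smul]
  have norm_toL2 : ‖toL2 u‖ ≤ 1 * ‖h‖ := norm_le_of_eq_fourierMultiplierCLM hm
    (fun x => (norm_m x).trans_le (inv_le_one_of_one_le₀ (by simp))) hu'
  have norm_lap : ‖(-((2 * π) ^ 2 : ℝ) : ℂ)⁻¹ • lap u‖ ≤ 1 * ‖h‖ :=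
    norm_le_of_eq_fourierMultiplierCLM (hm.mul hq) (fun x => by
      rw [Pi.mul_apply, norm_mul, norm_m, Complex.norm_real, Real.norm_of_nonneg (by positivity),
        inv_mul_le_one₀ (by positivity)]
      linarith) hlap
  rw [norm_smul, norm_inv, norm_neg, Complex.norm_real, Real.norm_of_nonneg (by positivity),
    inv_mul_le_iff₀ (by positivity)] at norm_lap
  linarith [norm_le_norm_lap_add_norm_toL2 u]

theorem exists_besselPotential_ofSchwartz_eq (ψ : 𝓢(E3, ℂ)) : ∃ φ : 𝓢(E3, ℂ),
    besselPotential E3 ℂ 2 ((ofSchwartz φ).toL2 : 𝓢'(E3, ℂ)) = (ψ.toLp 2 : L2) := by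
  refine ⟨SchwartzMap.fourierMultiplierCLM ℂ
    (fun x : E3 => (((1 + ‖x‖ ^ 2) ^ ((-2 : ℝ) / 2) : ℝ) : ℂ)) ψ, ?_⟩
  rw [← besselPotential_neg_apply_eq_iff, toL2_ofSchwartz, Lp.toTemperedDistribution_toLp_eq,
    Lp.toTemperedDistribution_toLp_eq, besselPotential,
    fourierMultiplierCLM_toTemperedDistributionCLM_eq (by fun_prop)]

theorem denseRange_ofSchwartz : DenseRange ofSchwartz := by
  refine Metric.denseRange_iff.2 fun f δ hδ => ?_
  obtain ⟨h, hh⟩ : MemSobolev 2 2 (f.toL2 : 𝓢'(E3, ℂ)) := f.2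
  have hC : 0 < (2 * π) ^ 2 + 1 := by positivity
  have hdense : DenseRange (SchwartzMap.toLpCLM ℝ ℂ 2 (volume : Measure E3)) :=
    SchwartzMap.denseRange_toLpCLM ENNReal.ofNat_ne_top
  obtain ⟨ψ, hψ⟩ : ∃ ψ : 𝓢(E3, ℂ), dist h (ψ.toLp 2 volume) < δ / ((2 * π) ^ 2 + 1) :=
    Metric.denseRange_iff.1 hdense h _ (div_pos hδ hC)
  obtain ⟨φ, hφ⟩ := exists_besselPotential_ofSchwartz_eq ψ
  have hsub : besselPotential E3 ℂ 2 ((f - ofSchwartz φ).toL2 : 𝓢'(E3, ℂ)) =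
      ((h - ψ.toLp 2 volume : L2) : 𝓢'(E3, ℂ)) := by
    have coe_sub (u v : L2) : ((u - v : L2) : 𝓢'(E3, ℂ)) = (u : 𝓢'(E3, ℂ)) - (v : 𝓢'(E3, ℂ)) :=
      map_sub (Lp.toTemperedDistributionCLM ℂ (volume : Measure E3) 2) u v
    rw [map_sub, coe_sub, map_sub, hh, hφ, ← coe_sub]
  refine ⟨φ, ?_⟩
  calc dist f (ofSchwartz φ) = ‖f - ofSchwartz φ‖ := dist_eq_norm _ _
    _ ≤ ((2 * π) ^ 2 + 1) * ‖h - ψ.toLp 2 volume‖ := norm_le_of_besselPotential_eq hsub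
    _ < δ := by rwa [← lt_div_iff₀' hC, ← dist_eq_norm]

end H2
end Density

section Extension

theorem angular_add {f g : E3 → ℂ} (hf : ContDiff ℝ 2 f) (hg : ContDiff ℝ 2 g) :
    angular (f + g) = angular f + angular g := by
  funext x
  obtain rfl | hx := eq_or_ne x 0
  · simp only [angular, dif_pos, Pi.add_apply, add_zero]
  have hfderiv : fderiv ℝ (f + g) = fderiv ℝ f + fderiv ℝ g := funext fun y =>
    fderiv_add (hf.differentiable two_ne_zero y) (hg.differentiable two_ne_zero y)
  have hfderiv2 : fderiv ℝ (fderiv ℝ (f + g)) x =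
      fderiv ℝ (fderiv ℝ f) x + fderiv ℝ (fderiv ℝ g) x := by
    rw [hfderiv]
    exact fderiv_add ((hf.fderiv_right le_rfl).differentiable one_ne_zero x)
      ((hg.fderiv_right le_rfl).differentiable one_ne_zero x)
  rw [Pi.add_apply, angular_eq hf hx, angular_eq hg hx, angular_eq (φ := f + g) (hf.add hg) hx,
    hf.contDiffAt.laplacian_add hg.contDiffAt, hfderiv2, hfderiv]
  simp only [Pi.add_apply, add_apply, smul_add]
  module

theorem angular_const_smul {f : E3 → ℂ} (hf : ContDiff ℝ 2 f) (c : ℂ) :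
    angular (c • f) = c • angular f := by
  funext x
  obtain rfl | hx := eq_or_ne x 0
  · simp only [angular, dif_pos, Pi.smul_apply, smul_zero]
  have hfderiv : fderiv ℝ (c • f) = c • fderiv ℝ f := funext fun y =>
    fderiv_const_smul (hf.differentiable two_ne_zero y) c
  have hfderiv2 : fderiv ℝ (fderiv ℝ (c • f)) x = c • fderiv ℝ (fderiv ℝ f) x := by
    rw [hfderiv]
    exact fderiv_const_smul ((hf.fderiv_right le_rfl).differentiable one_ne_zero x) c
  rw [Pi.smul_apply, angular_eq hf hx, angular_eq (φ := c • f) (hf.const_smul c) hx,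
    laplacian_smul c hf.contDiffAt, hfderiv2, hfderiv]
  simp only [Pi.smul_apply, smul_apply, smul_sub, smul_comm c]

/-- The space `C_c^∞(ℝ³)`, as a subspace of the Schwartz space. -/
def testSpace : Submodule ℂ 𝓢(E3, ℂ) where
  carrier := {φ | HasCompactSupport φ}
  add_mem' := HasCompactSupport.add
  zero_mem' := HasCompactSupport.zero
  smul_mem' c φ (hφ : HasCompactSupport φ) :=
    hφ.mono <| Function.support_const_smul_subset c φ

/-- The inclusion of `C_c^∞(ℝ³)` into `H²`. -/
def testToH2 : testSpace →ₗ[ℂ] H2 := H2.ofSchwartz ∘ₗ testSpace.subtype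

theorem coeFn_testToH2 (φ : testSpace) : H2.toL2 (testToH2 φ) =ᵐ[volume] φ.1 :=
  SchwartzMap.coeFn_toLp φ.1 2 volume

theorem denseRange_testToH2 : DenseRange testToH2 :=
  H2.denseRange_ofSchwartz.comp dense_hasCompactSupport.denseRange_val H2.continuous_ofSchwartz

/-- `Δ_{S²} / |x|²` on `C_c^∞(ℝ³)`, with values in `L²`. -/
def angularTest : testSpace →ₗ[ℂ] L2 where
  toFun φ := (memLp_angular φ.2).toLp (angular φ.1)
  map_add' φ ψ := by
    rw [← MemLp.toLp_add]
    exact MemLp.toLp_congr _ _ (.of_eq (angular_add (φ.1.smooth 2) (ψ.1.smooth 2)))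
  map_smul' c φ := by
    rw [RingHom.id_apply, ← MemLp.toLp_const_smul]
    exact MemLp.toLp_congr _ _ (.of_eq (angular_const_smul (φ.1.smooth 2) c))

theorem coeFn_angularTest (φ : testSpace) : angularTest φ =ᵐ[volume] angular φ.1 :=
  (memLp_angular φ.2).coeFn_toLp

theorem norm_angularTest_le (φ : testSpace) : ‖angularTest φ‖ ≤ 6 * ‖testToH2 φ‖ :=
  calc ‖angularTest φ‖ = (eLpNorm (angular φ.1) 2 volume).toReal :=
        Lp.norm_toLp _ (memLp_angular φ.2)
    _ ≤ (6 * eLpNorm (Δ φ.1 : 𝓢(E3, ℂ)) 2 volume).toReal :=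
        ENNReal.toReal_mono
          (ENNReal.mul_ne_top ENNReal.ofNat_ne_top ((Δ φ.1 : 𝓢(E3, ℂ)).memLp 2 volume).2.ne)
          (eLpNorm_angular_le φ.2)
    _ = 6 * ‖H2.lap (testToH2 φ)‖ := by
        rw [ENNReal.toReal_mul, ENNReal.toReal_ofNat, ← SchwartzMap.norm_toLp,
          ← H2.lap_ofSchwartz]
        rfl
    _ ≤ 6 * ‖testToH2 φ‖ := by gcongr; exact H2.norm_lap_le _

/-- The operator `Δ_{S²} / |x|² : H² → L²`. -/
def angularCLM : H2 →L[ℂ] L2 := angularTest.extendOfNorm testToH2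

theorem angularCLM_testToH2 (φ : testSpace) : angularCLM (testToH2 φ) = angularTest φ :=
  LinearMap.extendOfNorm_eq denseRange_testToH2 ⟨6, norm_angularTest_le⟩ φ

theorem norm_angularCLM_le : ‖angularCLM‖ ≤ 6 :=
  LinearMap.opNorm_extendOfNorm_le denseRange_testToH2 (by norm_num) norm_angularTest_le

theorem extendsAngular_angularCLM : ExtendsAngular angularCLM := fun φ hφ hc => by
  let ψ : testSpace := ⟨hc.toSchwartzMap hφ, hc⟩
  refine ⟨testToH2 ψ, coeFn_testToH2 ψ, ?_⟩
  rw [angularCLM_testToH2]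
  exact coeFn_angularTest ψ

theorem ExtendsAngular.eq_angularCLM {T : H2 →L[ℂ] L2} (hT : ExtendsAngular T) :
    T = angularCLM := by
  refine (LinearMap.extendOfNorm_unique denseRange_testToH2 6 norm_angularTest_le T ?_).symm
  ext1 φ
  obtain ⟨f, hf, hTf⟩ := hT φ.1 (φ.1.smooth ⊤) φ.2
  obtain rfl : f = testToH2 φ :=
    H2.toL2_injective (Lp.ext (hf.trans (coeFn_testToH2 φ).symm))
  exact Lp.ext (hTf.trans (coeFn_angularTest φ).symm)

end Extension

section WeakFormulation

theorem continuous_integral_mul {α 𝕜 : Type*} [MeasurableSpace α] {μ : Measure α} [RCLike 𝕜]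
    {φ : α → 𝕜} (hφ : MemLp φ 2 μ) : Continuous fun f : Lp 𝕜 2 μ => ∫ x, f x * φ x ∂μ := by
  have hinner (f : Lp 𝕜 2 μ) : ∫ x, f x * φ x ∂μ = inner 𝕜 (hφ.star.toLp (star φ)) f := by
    rw [L2.inner_def]
    refine integral_congr_ae ?_
    filter_upwards [hφ.star.coeFn_toLp] with x hx
    rw [hx, RCLike.inner_apply, Pi.star_apply, RCLike.star_def, RCLike.conj_conj]
  simp only [hinner]
  fun_prop

theorem isWeakAngular_angularCLM (f : H2) : IsWeakAngular f.toL2 (angularCLM f) := by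
  intro φ hφ hc h0
  let χ : 𝓢(E3, ℂ) := hc.toSchwartzMap hφ
  refine denseRange_testToH2.induction_on f ?_ fun ψ => ?_
  · exact isClosed_eq ((continuous_integral_mul (χ.memLp 2)).comp angularCLM.continuous)
      ((continuous_integral_mul (memLp_angular (φ := χ) hc)).comp H2.continuous_toL2)
  · calc ∫ x, angularCLM (testToH2 ψ) x * φ x = ∫ x, angular ψ.1 x * φ x := by
          rw [angularCLM_testToH2]
          exact integral_congr_ae ((coeFn_angularTest ψ).mul .rfl)
      _ = ∫ x, ψ.1 x * angular φ x := integral_angular_mul (φ := χ) ψ.2 hc h0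
      _ = ∫ x, (testToH2 ψ).toL2 x * angular φ x :=
          integral_congr_ae ((coeFn_testToH2 ψ).symm.mul .rfl)

theorem IsWeakAngular.unique {f g g' : L2} (hg : IsWeakAngular f g) (hg' : IsWeakAngular f g') :
    g = g' := by
  have hloc : LocallyIntegrable (g - g' : E3 → ℂ) volume :=
    ((Lp.memLp g).locallyIntegrable one_le_two).sub ((Lp.memLp g').locallyIntegrable one_le_two)
  have heq : ∀ᵐ x : E3, x ∈ ({0}ᶜ : Set E3) → (g - g' : E3 → ℂ) x = 0 := by
    refine isOpen_compl_singleton.ae_eq_zero_of_integral_contDiff_smul_eq_zero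
      (hloc.locallyIntegrableOn _) fun η hη hc hsupp => ?_
    have hcont : ContDiff ℝ ∞ fun x => (η x : ℂ) := Complex.ofRealCLM.contDiff.comp hη
    have hc' : HasCompactSupport fun x => (η x : ℂ) := hc.comp_left Complex.ofReal_zero
    have h0 : (0 : E3) ∉ tsupport fun x => (η x : ℂ) := fun h =>
      hsupp (tsupport_comp_subset Complex.ofReal_zero η h) rfl
    have hmem : MemLp (fun x => (η x : ℂ)) 2 volume :=
      hcont.continuous.memLp_of_hasCompactSupport hc'
    have hint (u : L2) : Integrable fun x => u x * (η x : ℂ) := (Lp.memLp u).integrable_mul hmem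
    calc ∫ x, η x • (g - g' : E3 → ℂ) x = ∫ x, g x * (η x : ℂ) - g' x * (η x : ℂ) := by
          simp only [Complex.real_smul, Pi.sub_apply, mul_sub, mul_comm]
      _ = 0 := by
          rw [integral_sub (hint g) (hint g'), hg _ hcont hc' h0, hg' _ hcont hc' h0, sub_self]
  refine Lp.ext ?_
  filter_upwards [heq, Measure.ae_ne volume 0] with x hx hx0 using sub_eq_zero.1 (hx hx0)

end WeakFormulation

end SphericalHardy

end

theorem mainTheorem10 :
    (∀ f : SphericalHardy.H2, ∃! g : SphericalHardy.L2,
      SphericalHardy.IsWeakAngular f.toL2 g) ∧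
    (∀ (f : SphericalHardy.H2) (g : SphericalHardy.L2),
      SphericalHardy.IsWeakAngular f.toL2 g → ‖g‖ ≤ 22 * ‖f‖) ∧
    ∃ T : SphericalHardy.H2 →L[ℂ] SphericalHardy.L2,
      SphericalHardy.ExtendsAngular T ∧
      (∀ T' : SphericalHardy.H2 →L[ℂ] SphericalHardy.L2,
        SphericalHardy.ExtendsAngular T' → T' = T) ∧
      (∀ f : SphericalHardy.H2, SphericalHardy.IsWeakAngular f.toL2 (T f)) ∧
      ‖T‖ ≤ 22 := by
  have hnorm : ‖SphericalHardy.angularCLM‖ ≤ 22 :=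
    SphericalHardy.norm_angularCLM_le.trans (by norm_num)
  refine ⟨fun f => ⟨SphericalHardy.angularCLM f, SphericalHardy.isWeakAngular_angularCLM f,
    fun g hg => hg.unique (SphericalHardy.isWeakAngular_angularCLM f)⟩, fun f g hg => ?_,
    SphericalHardy.angularCLM, SphericalHardy.extendsAngular_angularCLM,
    fun T' hT' => hT'.eq_angularCLM, SphericalHardy.isWeakAngular_angularCLM,
    hnorm⟩
  rw [hg.unique (SphericalHardy.isWeakAngular_angularCLM f)]
  exact SphericalHardy.angularCLM.le_of_opNorm_le hnorm f
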